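/- Let $d\in\mathbb N$ and $1<p\le\infty$. Functions on the torus $\mathbb R^d/\mathbb Z^d$ are identified with functions on $\mathbb R^d$ that are $1$-periodic in each coordinate; spatial integrals and $L^p$ norms are taken over $[0,1)^d$, and $|x-y|$ denotes the distance $\min_{k\in\mathbb Z^d}|x-y+k|$ on the torus. For measurable periodic $\rho$ with values in $\{\pm1\}$ and $\int\rho\,dx=0$ put $\rho_+=2\max\{\rho,0\}$, $\rho_-=-2\min\{\rho,0\}$, and $$D(\rho)=\exp\Big(\inf_{\pi\in\Gamma(\rho_+,\rho_-)}\iint\ln|x-y|\,d\pi(x,y)\Big)\in[0,\infty),$$ where $\Gamma(\rho_+,\rho_-)$ is the set of probability measures on $[0,1)^d\times[0,1)^d$ with marginals $\rho_+\,dx$ and $\rho_-\,dy$, $\ln0=-\infty$ and $\exp(-\infty)=0$. There is a constant $c>0$, depending only on $p$ and $d$, with the following properties. Let $T>0$. (i) Let $u:[0,T]\times\mathbb R^d\to\mathbb R^d$ be smooth, periodic in space, with $\operatorname{div}u=0$, and let $\rho:[0,T]\times\mathbb R^d\to\{\pm1\}$ be measurable, periodic in space, with $\int\rho(0,\cdot)\,dx=0$,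 and solve $\partial_t\rho+u\cdot\nabla\rho=0$ with initial value $\rho_0=\rho(0,\cdot)$ in the weak sense, that is, $$\int\rho(t)\varphi(t)\,dx-\int\rho_0\varphi(0)\,dx=\int_0^t\!\!\int\rho\,(\partial_t\varphi+u\cdot\nabla\varphi)\,dx\,ds$$ for all $t\in[0,T]$ and all smooth, spatially periodic $\varphi:\mathbb R\times\mathbb R^d\to\mathbb R$. Then $$D(\rho(T))\ \ge\ D(\rho_0)\exp\Big(-c\int_0^T\|\nabla u(t)\|_{L^p}\,dt\Big);$$ in particular $D(\rho(T))>0$ if $D(\rho_0)>0$. (ii) Perfect mixing in finite time is impossible: if $u$ and $\rho$ are as in (i) with $[0,T)$ in place of $[0,T]$, and $\int_0^T\|\nabla u(t)\|_{L^p}\,dt<\infty$ and $D(\rho_0)>0$, then there is $\delta>0$ with $D(\rho(t))\ge\delta$ for all $t\in[0,T)$. -/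

import Mathlib

open MeasureTheory Set
open scoped ENNReal NNReal ContDiff

noncomputable section

namespace Mixing

/-- Euclidean space `ℝ^d`. Functions on the torus are functions on `ℝ^d` with period `1` in each
coordinate direction, and spatial integrals are taken over the period cell. -/
abbrev Space (d : ℕ) : Type := EuclideanSpace ℝ (Fin d)

/-- The period cell `[0,1)^d`. -/
def cell (d : ℕ) : Set (Space d) := {x | ∀ i, x i ∈ Ico (0 : ℝ) 1}

/-- Period `1` in each coordinate direction. -/
def IsPeriodic {d : ℕ} {α : Type*} (f : Space d → α) : Prop :=
  ∀ i : Fin d, Function.Periodic f (EuclideanSpace.single i (1 : ℝ))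

/-- The distance `|x - y|` of points of the torus `ℝ^d / ℤ^d`. -/
def torusDist {d : ℕ} (x y : Space d) : ℝ :=
  ⨅ k : Fin d → ℤ, ‖x - y + WithLp.toLp 2 (fun i => (k i : ℝ))‖

/-- The measure `f dx` on the period cell. -/
def densityMeasure {d : ℕ} (f : Space d → ℝ) : Measure (Space d) :=
  (volume.restrict (cell d)).withDensity fun x => ENNReal.ofReal (f x)

/-- The transport plans from `f dx` to `g dy`. The marginal conditions force a plan to be
concentrated on the product of the period cell with itself. -/
def transportPlans {d : ℕ} (f g : Space d → ℝ) : Set (Measure (Space d × Space d)) :=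
  {π | IsProbabilityMeasure π ∧ π.map Prod.fst = densityMeasure f ∧
    π.map Prod.snd = densityMeasure g}

/-- The integral of an extended-real function, as the integral of its positive part minus the
integral of its negative part. -/
def extIntegral {α : Type*} [MeasurableSpace α] (μ : Measure α) (f : α → EReal) : EReal :=
  ((∫⁻ a, (f a).toENNReal ∂μ : ℝ≥0∞) : EReal) - ((∫⁻ a, (-f a).toENNReal ∂μ : ℝ≥0∞) : EReal)

/-- The Monge-Kantorovich-Rubinstein distance with cost function `σ`. -/
def mkrDist {d : ℕ} (σ : ℝ → EReal) (f g : Space d → ℝ) : EReal :=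
  ⨅ π ∈ transportPlans f g, extIntegral π fun z => σ (torusDist z.1 z.2)

/-- The cost function `ln : [0,∞) → ℝ ∪ {-∞}`, with `ln 0 = -∞`. -/
def lnCost (z : ℝ) : EReal := ENNReal.log (ENNReal.ofReal z)

/-- The logarithmic mixing measure `D(ρ) = exp (d_ln (ρ₊, ρ₋))`, where `exp (-∞) = 0`. -/
def mixingMeasure {d : ℕ} (ρ : Space d → ℝ) : ℝ≥0∞ :=
  EReal.exp (mkrDist lnCost (fun x => 2 * max (ρ x) 0) (fun x => -2 * min (ρ x) 0))

/-- `u` is a velocity field on the time interval `J` that is smooth in time and space, periodic in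
space, and divergence-free. -/
structure IsStirringField {d : ℕ} (J : Set ℝ) (u : ℝ → Space d → Space d) : Prop where
  smooth : ContDiffOn ℝ ∞ (fun z : ℝ × Space d => u z.1 z.2) (J ×ˢ univ)
  periodic : ∀ t ∈ J, IsPeriodic (u t)
  div_free : ∀ t ∈ J, ∀ x, ∑ i, fderiv ℝ (u t) x (EuclideanSpace.single i 1) i = 0

/-- `ρ` is a periodic `±1`-valued function on `J × ℝ^d`, with initial value `ρ 0` of mean zero,
that solves `∂ₜρ + u · ∇ρ = 0` in the sense of distributions, with `ρ t` the trace at time `t`.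
Here `J` is an interval with left end point `0` that belongs to `J`. -/
structure IsBinarySolution {d : ℕ} (J : Set ℝ) (u : ℝ → Space d → Space d)
    (ρ : ℝ → Space d → ℝ) : Prop where
  measurable : AEStronglyMeasurable (fun z : ℝ × Space d => ρ z.1 z.2)
    (volume.restrict (J ×ˢ univ))
  measurable_slice : ∀ t ∈ J, AEStronglyMeasurable (ρ t) volume
  periodic : ∀ t ∈ J, IsPeriodic (ρ t)
  binary : ∀ t ∈ J, ∀ x, ρ t x = 1 ∨ ρ t x = -1
  mean_zero : ∫ x in cell d, ρ 0 x = 0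
  weak : ∀ φ : ℝ → Space d → ℝ, ContDiff ℝ ∞ (fun z : ℝ × Space d => φ z.1 z.2) →
    (∀ t, IsPeriodic (φ t)) → ∀ t ∈ J,
      (∫ x in cell d, ρ t x * φ t x) - ∫ x in cell d, ρ 0 x * φ 0 x =
        ∫ s in (0 : ℝ)..t, ∫ x in cell d,
          ρ s x * (deriv (fun r => φ r x) s + fderiv ℝ (φ s) x (u s x))

/-- The time integral over `J` of the norm of `∇u` in `L^p` of the period cell. -/
def gradBudget {d : ℕ} (p : ℝ≥0∞) (J : Set ℝ) (u : ℝ → Space d → Space d) : ℝ≥0∞ :=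
  ∫⁻ t in J, eLpNorm (fun x => fderiv ℝ (u t) x) p (volume.restrict (cell d))

end Mixing

end

noncomputable section

namespace Mixing

/-! Let `X(s,x)` be the position at time `s` of the particle that sits at `x` at time `T`. The
difference quotient of `u` at `a`, `b` is at most `2^d (M|∇u|(a) + M|∇u|(b))`, where `M` is a
maximal operator over bounded radii (`norm_sub_le_maximalFun`). Grönwall's inequality backwards in
time then bounds `ln|X(0,x) - X(0,y)| - ln|x - y|` by the integral over `s` of `2^d (M|∇u|(s,
X(s,x)) + M|∇u|(s, X(s,y)))`.

The flow carries `ρ₊(T) dx` and `ρ₋(T) dx` to `ρ₊(s) dx` and `ρ₋(s) dx`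
(`IsBinarySolution.map_flow`), so it pushes any plan `π` at time `T` to a plan at time `0`, whose
cost exceeds that of `π` by at most the `π`-integral of the bound above. Each term there involves
one marginal only and turns into an integral of `M|∇u|(s)` against a density at most `2`. Since `M`
maps `L^q` to `L¹` for `q > 1` (`exists_lintegral_maximalFun_le`), the excess is at most `c ∫
‖∇u‖_p`, whatever `π` is. The infimum over `π` gives `exists_mkrDist_le_add_gradBudget`;
exponentiating gives (i), and (ii) is (i) on every `[0,t]`, with the budget bounded by that of
`[0,T)`.

As `ρ` is only a weak solution, its transport by the flow needs an argument. A Lipschitz function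
pulled back along the flow is mollified in space-time and used as a test function
(`IsBinarySolution.integral_comp_flow`). This transports the difference of `ρ₊ dx` and `ρ₋ dx`; the
two measures are then transported separately because they form a Jordan decomposition whose total
mass is the same at all times. -/

/-! ### Periodic functions, the period cell and the torus distance -/

/-- The lattice vector with integer coordinates `k`. -/
def latticeVec {d : ℕ} (k : Fin d → ℤ) : Space d := WithLp.toLp 2 (fun i => (k i : ℝ))

@[simp]
lemma latticeVec_apply {d : ℕ} (k : Fin d → ℤ) (i : Fin d) : latticeVec k i = (k i : ℝ) := rfl

lemma IsPeriodic.add_latticeVec {d : ℕ} {α : Type*} {f : Space d → α} (hf : IsPeriodic f)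
    (x : Space d) (k : Fin d → ℤ) : f (x + latticeVec k) = f x := by
  have key : ∀ s : Finset (Fin d), ∀ x,
      f (x + ∑ i ∈ s, k i • EuclideanSpace.single i (1 : ℝ)) = f x := by
    intro s
    induction s using Finset.induction_on with
    | empty => simp
    | insert i s hi ih =>
      intro x
      rw [Finset.sum_insert hi, ← add_assoc, ih, (hf i).zsmul (k i) x]
  have : latticeVec k = ∑ i, k i • EuclideanSpace.single i (1 : ℝ) := by
    ext j
    simp [Finset.sum_apply, Pi.single_apply]
  rw [this, key]

lemma isPeriodic_of_add_latticeVec {d : ℕ} {α : Type*} {f : Space d → α}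
    (hf : ∀ x k, f (x + latticeVec k) = f x) : IsPeriodic f := by
  intro i x
  have : EuclideanSpace.single i (1 : ℝ) = latticeVec (d := d) (Pi.single i 1) := by
    ext j
    simp [Pi.single_apply]
  rw [this, hf]

/-- The representative of `x` in the period cell. -/
def wrap {d : ℕ} (x : Space d) : Space d := WithLp.toLp 2 (fun i => Int.fract (x i))

lemma wrap_eq {d : ℕ} (x : Space d) : wrap x = x + latticeVec (fun i => -⌊x i⌋) := by
  ext i
  simp [wrap, Int.fract, sub_eq_add_neg]

lemma wrap_mem_cell {d : ℕ} (x : Space d) : wrap x ∈ cell d := fun _ =>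
  ⟨Int.fract_nonneg _, Int.fract_lt_one _⟩

lemma wrap_of_mem_cell {d : ℕ} {x : Space d} (hx : x ∈ cell d) : wrap x = x := by
  ext i
  exact Int.fract_eq_self.2 ⟨(hx i).1, (hx i).2⟩

lemma measurable_wrap {d : ℕ} : Measurable (wrap : Space d → Space d) := by
  refine (WithLp.measurable_toLp 2 _).comp (measurable_pi_lambda _ fun i => ?_)
  exact measurable_fract.comp ((PiLp.continuous_apply 2 _ i).measurable)

lemma IsPeriodic.comp_wrap {d : ℕ} {α : Type*} {f : Space d → α} (hf : IsPeriodic f)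
    (x : Space d) : f (wrap x) = f x := by
  rw [wrap_eq, hf.add_latticeVec]

lemma measurableSet_cell (d : ℕ) : MeasurableSet (cell d) := by
  have : cell d = ⋂ i, (fun x : Space d => x i) ⁻¹' Ico (0 : ℝ) 1 := by
    ext x; simp [cell]
  rw [this]
  exact MeasurableSet.iInter fun i =>
    (PiLp.continuous_apply 2 _ i).measurable measurableSet_Ico

lemma volume_cell (d : ℕ) : volume (cell d) = 1 := by
  have h := (EuclideanSpace.volume_preserving_symm_measurableEquiv_toLp (Fin d)).measure_preimage
    (s := univ.pi fun _ => Ico (0 : ℝ) 1)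
    (MeasurableSet.univ_pi fun _ => measurableSet_Ico).nullMeasurableSet
  rw [Real.volume_pi_Ico] at h
  have e : cell d = (MeasurableEquiv.toLp 2 (Fin d → ℝ)).symm ⁻¹'
      (univ.pi fun _ => Ico (0 : ℝ) 1) := by
    ext x
    simp [cell, mem_pi]
  rw [e, h]
  simp

instance isProbabilityMeasure_restrict_cell (d : ℕ) :
    IsProbabilityMeasure ((volume : Measure (Space d)).restrict (cell d)) :=
  ⟨by rw [Measure.restrict_apply_univ, volume_cell]⟩

lemma norm_le_of_abs_le_one {d : ℕ} {v : Space d} (h : ∀ i, |v i| ≤ 1) : ‖v‖ ≤ d + 1 := by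
  rw [EuclideanSpace.norm_eq]
  have h1 : ∑ i, ‖v i‖ ^ 2 ≤ ∑ _i : Fin d, (1 : ℝ) :=
    Finset.sum_le_sum fun i _ => by
      have := h i
      rw [Real.norm_eq_abs]
      nlinarith [abs_nonneg (v i)]
  rw [Finset.sum_const, Finset.card_univ, Fintype.card_fin, nsmul_eq_mul, mul_one] at h1
  refine Real.sqrt_le_iff.2 ⟨by positivity, h1.trans ?_⟩
  nlinarith [(Nat.cast_nonneg d : (0 : ℝ) ≤ d)]

lemma exists_norm_add_latticeVec_le {d : ℕ} (v : Space d) :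
    ∃ k : Fin d → ℤ, ‖v + latticeVec k‖ ≤ d + 1 := by
  refine ⟨fun i => -⌊v i⌋, ?_⟩
  rw [← wrap_eq]
  exact norm_le_of_abs_le_one fun i => by
    rw [abs_of_nonneg (wrap_mem_cell v i).1]
    exact (wrap_mem_cell v i).2.le

lemma norm_le_of_mem_cell {d : ℕ} {x : Space d} (hx : x ∈ cell d) : ‖x‖ ≤ d + 1 :=
  norm_le_of_abs_le_one fun i => by
    rw [abs_of_nonneg (hx i).1]
    exact (hx i).2.le

lemma torusDist_bddBelow {d : ℕ} (x y : Space d) :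
    BddBelow (range fun k : Fin d → ℤ => ‖x - y + latticeVec k‖) :=
  ⟨0, by rintro _ ⟨k, rfl⟩; exact norm_nonneg _⟩

lemma torusDist_le {d : ℕ} (x y : Space d) (k : Fin d → ℤ) :
    torusDist x y ≤ ‖x - y + latticeVec k‖ :=
  ciInf_le (torusDist_bddBelow x y) k

lemma torusDist_le_diam {d : ℕ} (x y : Space d) : torusDist x y ≤ d + 1 := by
  obtain ⟨k, hk⟩ := exists_norm_add_latticeVec_le (x - y)
  exact (torusDist_le x y k).trans hk

lemma torusDist_add_latticeVec {d : ℕ} (x y : Space d) (k l : Fin d → ℤ) :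
    torusDist (x + latticeVec k) (y + latticeVec l) = torusDist x y := by
  unfold torusDist
  refine Equiv.iInf_congr (Equiv.addRight (k - l)) fun m => ?_
  congr 1
  ext i
  simp
  ring

lemma torusDist_wrap {d : ℕ} (x y : Space d) : torusDist (wrap x) (wrap y) = torusDist x y := by
  rw [wrap_eq, wrap_eq, torusDist_add_latticeVec]

lemma measurable_torusDist {d : ℕ} :
    Measurable fun z : Space d × Space d => torusDist z.1 z.2 := by
  unfold torusDist
  exact Measurable.iInf fun k => by fun_prop

/-- Finitely many lattice translates of the cell cover the ball. This brings covering arguments in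
`ℝ^d` back to the cell, with `N` independent of `f`. -/
lemma exists_lintegral_closedBall_le (d : ℕ) (r : ℝ) :
    ∃ N : ℕ, ∀ f : Space d → ℝ≥0∞, IsPeriodic f →
      ∫⁻ x in Metric.closedBall 0 r, f x ≤ N * ∫⁻ x in cell d, f x := by
  classical
  obtain ⟨n, hn⟩ := exists_nat_ge r
  let F : Finset (Fin d → ℤ) := Fintype.piFinset fun _ => Finset.Icc (-(n : ℤ) - 1) (n + 1)
  refine ⟨F.card, fun f hf => ?_⟩
  have hcov : Metric.closedBall (0 : Space d) r ⊆
      ⋃ k : F, (fun x => x + latticeVec (-k.1)) ⁻¹' cell d := by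
    intro x hx
    simp only [mem_iUnion]
    refine ⟨⟨fun i => ⌊x i⌋, ?_⟩, ?_⟩
    · refine Fintype.mem_piFinset.2 fun i => ?_
      have h1 : |x i| ≤ n := by
        have := PiLp.norm_apply_le x i
        rw [Real.norm_eq_abs] at this
        exact this.trans ((mem_closedBall_zero_iff.1 hx).trans hn)
      rw [abs_le] at h1
      rw [Finset.mem_Icc]
      constructor
      · rw [Int.le_floor]; push_cast; linarith
      · have : (⌊x i⌋ : ℝ) ≤ n + 1 := (Int.floor_le _).trans (by linarith)
        exact_mod_cast this
    · have := wrap_mem_cell x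
      rw [wrap_eq] at this
      exact this
  calc ∫⁻ x in Metric.closedBall 0 r, f x
      ≤ ∫⁻ x in ⋃ k : F, (fun x => x + latticeVec (-k.1)) ⁻¹' cell d, f x :=
        lintegral_mono_set hcov
    _ ≤ ∑' k : F, ∫⁻ x in (fun x => x + latticeVec (-k.1)) ⁻¹' cell d, f x :=
        lintegral_iUnion_le _ _
    _ = ∑' _k : F, ∫⁻ x in cell d, f x := by
        refine tsum_congr fun k => ?_
        have h := (measurePreserving_add_right (volume : Measure (Space d))
          (latticeVec (-k.1))).setLIntegral_comp_preimage_emb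
          (MeasurableEquiv.addRight (latticeVec (-k.1))).measurableEmbedding f (cell d)
        rw [← h]
        refine lintegral_congr fun x => ?_
        rw [hf.add_latticeVec]
    _ = F.card * ∫⁻ x in cell d, f x := by simp [tsum_fintype]

/-! ### The maximal function and its `L^q`-to-`L¹` bound -/

/-- The mean of `f` over the closed ball with centre `x` and radius `r`, which for `r = 0` is the
value `f x`. -/
def ballAvg {d : ℕ} (f : Space d → ℝ) (r : ℝ) (x : Space d) : ℝ :=
  (volume.real (Metric.closedBall (0 : Space d) 1))⁻¹ *
    ∫ w in Metric.closedBall (0 : Space d) 1, f (x + r • w)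

/-- The maximal function of `f` over radii in `[0, R]`. -/
def maximalFun {d : ℕ} (R : ℝ) (f : Space d → ℝ) (x : Space d) : ℝ :=
  sSup ((fun r => ballAvg f r x) '' Icc 0 R)

lemma volume_real_unitBall_pos (d : ℕ) :
    0 < volume.real (Metric.closedBall (0 : Space d) 1) :=
  ENNReal.toReal_pos (Metric.measure_closedBall_pos _ _ one_pos).ne'
    measure_closedBall_lt_top.ne

lemma continuous_ballAvg {d : ℕ} {X : Type*} [TopologicalSpace X] [FirstCountableTopology X]
    [LocallyCompactSpace X]
    {F : X → Space d → ℝ} (hF : Continuous fun z : X × Space d => F z.1 z.2) :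
    Continuous fun z : (X × Space d) × ℝ => ballAvg (F z.1.1) z.2 z.1.2 := by
  refine continuous_const.mul ?_
  refine continuous_parametric_integral_of_continuous
    (f := fun (z : (X × Space d) × ℝ) w => F z.1.1 (z.1.2 + z.2 • w)) ?_
    (isCompact_closedBall _ _)
  exact hF.comp (f := fun q : ((X × Space d) × ℝ) × Space d => (q.1.1.1, q.1.1.2 + q.1.2 • q.2))
    (by fun_prop)

/-- Averages written over the unit ball are jointly continuous in all variables, down to radius `0`,
and the radii fill a compact interval, so the supremum is continuous. The parameter space serves for
the time variable. -/
lemma continuous_maximalFun_param {d : ℕ} {X : Type*} [TopologicalSpace X]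
    [FirstCountableTopology X] [LocallyCompactSpace X] (R : ℝ)
    {F : X → Space d → ℝ} (hF : Continuous fun z : X × Space d => F z.1 z.2) :
    Continuous fun z : X × Space d => maximalFun R (F z.1) z.2 :=
  IsCompact.continuous_sSup (f := fun (z : X × Space d) r => ballAvg (F z.1) r z.2)
    isCompact_Icc (continuous_ballAvg hF)

lemma continuous_ballAvg_radius {d : ℕ} {f : Space d → ℝ} (hf : Continuous f) (x : Space d) :
    Continuous fun r => ballAvg f r x := by
  have h := continuous_ballAvg (X := Unit) (F := fun _ => f) (hf.comp continuous_snd)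
  exact h.comp (f := fun r : ℝ => (((), x), r)) (by fun_prop)

lemma continuous_maximalFun {d : ℕ} (R : ℝ) {f : Space d → ℝ} (hf : Continuous f) :
    Continuous (maximalFun R f) := by
  have h := continuous_maximalFun_param (X := Unit) R (F := fun _ => f) (hf.comp continuous_snd)
  exact h.comp (f := fun x => ((), x)) (by fun_prop)

lemma ballAvg_le_maximalFun {d : ℕ} {R r : ℝ} {f : Space d → ℝ} (hf : Continuous f)
    (hr : r ∈ Icc 0 R) (x : Space d) : ballAvg f r x ≤ maximalFun R f x :=
  le_csSup ((isCompact_Icc.image (continuous_ballAvg_radius hf x)).bddAbove)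
    (mem_image_of_mem _ hr)

lemma ballAvg_nonneg {d : ℕ} {f : Space d → ℝ} (h0 : ∀ x, 0 ≤ f x) (r : ℝ) (x : Space d) :
    0 ≤ ballAvg f r x :=
  mul_nonneg (by positivity) (integral_nonneg fun _ => h0 _)

lemma maximalFun_nonneg {d : ℕ} {R : ℝ} {f : Space d → ℝ} (h0 : ∀ x, 0 ≤ f x) (x : Space d) :
    0 ≤ maximalFun R f x := by
  refine Real.sSup_nonneg ?_
  rintro _ ⟨r, -, rfl⟩
  exact ballAvg_nonneg h0 r x

lemma isPeriodic_maximalFun {d : ℕ} {R : ℝ} {f : Space d → ℝ} (hf : IsPeriodic f) :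
    IsPeriodic (maximalFun R f) := by
  refine isPeriodic_of_add_latticeVec fun x k => ?_
  unfold maximalFun ballAvg
  have h : ∀ (r : ℝ) (w : Space d), f (x + latticeVec k + r • w) = f (x + r • w) := fun r w => by
    rw [add_right_comm, hf.add_latticeVec]
  simp only [h]

/-- If the supremum is attained only near radius `0`, continuity in the radius supplies a small
positive one; the covering argument needs balls with interior. -/
lemma exists_radius_of_lt_maximalFun {d : ℕ} {R l : ℝ} (hR : 0 < R) {f : Space d → ℝ}
    (hf : Continuous f) {x : Space d} (hl : l < maximalFun R f x) :
    ∃ r ∈ Ioc 0 R, l < ballAvg f r x := by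
  obtain ⟨_, ⟨r, hr, rfl⟩, hlr⟩ := exists_lt_of_lt_csSup
    ((nonempty_Icc.2 hR.le).image _) hl
  rcases hr.1.eq_or_lt with h0 | h0
  · subst h0
    have h1 : ∀ᶠ r in nhdsWithin (0 : ℝ) (Ioi 0), l < ballAvg f r x :=
      ((continuous_ballAvg_radius hf x).tendsto 0).mono_left nhdsWithin_le_nhds
        |>.eventually (lt_mem_nhds hlr)
    obtain ⟨r, h2, h3⟩ := (h1.and (Ioc_mem_nhdsGT hR)).exists
    exact ⟨r, h3, h2⟩
  · exact ⟨r, ⟨h0, hr.2⟩, hlr⟩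

lemma setIntegral_smul_add {d : ℕ} (f : Space d → ℝ) {r : ℝ} (hr : 0 < r) (x c : Space d)
    (a : ℝ) (ha : 0 ≤ a) :
    ∫ w in Metric.closedBall c a, f (x + r • w) =
      (r ^ d)⁻¹ * ∫ w in Metric.closedBall (x + r • c) (r * a), f w := by
  have h := Measure.setIntegral_comp_smul_of_pos (volume : Measure (Space d))
    (fun w => f (x + w)) (Metric.closedBall c a) hr
  rw [h, smul_closedBall _ _ ha, finrank_euclideanSpace_fin, Real.norm_of_nonneg hr.le,
    smul_eq_mul]
  congr 1
  have h2 := (measurePreserving_add_left (volume : Measure (Space d)) x).setIntegral_preimage_emb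
    (MeasurableEquiv.addLeft x).measurableEmbedding f (Metric.closedBall (x + r • c) (r * a))
  rw [← h2]
  congr 2
  ext w
  simp [dist_eq_norm]

lemma volume_closedBall_eq {d : ℕ} (x : Space d) {r : ℝ} (hr : 0 ≤ r) :
    volume (Metric.closedBall x r) =
      ENNReal.ofReal (r ^ d) * volume (Metric.closedBall (0 : Space d) 1) := by
  rw [Measure.addHaar_closedBall' _ _ hr, finrank_euclideanSpace_fin]

lemma ballAvg_eq {d : ℕ} (f : Space d → ℝ) {r : ℝ} (hr : 0 < r) (x : Space d) :
    ballAvg f r x = (volume.real (Metric.closedBall (0 : Space d) 1))⁻¹ *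
      ((r ^ d)⁻¹ * ∫ w in Metric.closedBall x r, f w) := by
  rw [ballAvg, setIntegral_smul_add f hr x 0 1 zero_le_one, smul_zero, add_zero, mul_one]

lemma ofReal_ballAvg_mul_volume {d : ℕ} {f : Space d → ℝ} (hf : Continuous f)
    (h0 : ∀ x, 0 ≤ f x) {r : ℝ} (hr : 0 < r) (x : Space d) :
    ENNReal.ofReal (ballAvg f r x) * volume (Metric.closedBall x r) =
      ∫⁻ w in Metric.closedBall x r, ENNReal.ofReal (f w) := by
  have hb := volume_real_unitBall_pos d
  rw [← ofReal_integral_eq_lintegral_ofReal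
    (hf.continuousOn.integrableOn_compact (isCompact_closedBall x r))
    (Filter.Eventually.of_forall h0), volume_closedBall_eq x hr.le,
    ← ofReal_measureReal (measure_closedBall_lt_top.ne), ← ENNReal.ofReal_mul (by positivity),
    ← ENNReal.ofReal_mul (ballAvg_nonneg h0 _ _), ballAvg_eq f hr]
  congr 1
  field_simp

/-- Vitali covering: each point of the superlevel set is the centre of a ball on which the mean of
`f` exceeds `l`. A disjoint subfamily covers the set after enlargement by `5`, which costs `5 ^ d`
in volume. -/
lemma exists_weakType_maximalFun (d : ℕ) {R : ℝ} (hR : 0 < R) :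
    ∃ C : ℝ≥0, ∀ f : Space d → ℝ, Continuous f → (∀ x, 0 ≤ f x) → IsPeriodic f → ∀ l : ℝ,
      ENNReal.ofReal l * volume {x ∈ cell d | l < maximalFun R f x} ≤
        C * ∫⁻ x in cell d, ENNReal.ofReal (f x) := by
  obtain ⟨N, hN⟩ := exists_lintegral_closedBall_le d (d + 1 + R)
  refine ⟨5 ^ d * N, fun f hf h0 hper l => ?_⟩
  let t : Set (Space d × ℝ) := {a | a.1 ∈ cell d ∧ a.2 ∈ Ioc 0 R ∧ l < ballAvg f a.2 a.1}
  obtain ⟨v, hvt, hdisj, hcov⟩ := Vitali.exists_disjoint_subfamily_covering_enlargement_closedBall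
    t (fun a => a.1) (fun a => a.2) R (fun a ha => ha.2.1.2) 5 (by norm_num)
  have hcount : v.Countable := hdisj.countable_of_nonempty_interior fun a ha => by
    refine ⟨a.1, ?_⟩
    exact Metric.ball_subset_interior_closedBall (Metric.mem_ball_self (hvt ha).2.1.1)
  have hsub : {x ∈ cell d | l < maximalFun R f x} ⊆
      ⋃ a ∈ v, Metric.closedBall a.1 (5 * a.2) := by
    rintro x ⟨hx, hl⟩
    obtain ⟨r, hr, hlr⟩ := exists_radius_of_lt_maximalFun hR hf hl
    obtain ⟨b, hb, hxb⟩ := hcov (x, r) ⟨hx, hr, hlr⟩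
    exact mem_biUnion hb (hxb (Metric.mem_closedBall_self hr.1.le))
  calc ENNReal.ofReal l * volume {x ∈ cell d | l < maximalFun R f x}
      ≤ ENNReal.ofReal l * ∑' a : v, volume (Metric.closedBall a.1.1 (5 * a.1.2)) := by
        gcongr
        exact (measure_mono hsub).trans (measure_biUnion_le _ hcount _)
    _ = ∑' a : v, ENNReal.ofReal l * volume (Metric.closedBall a.1.1 (5 * a.1.2)) :=
        ENNReal.tsum_mul_left.symm
    _ ≤ ∑' a : v, 5 ^ d * ∫⁻ w in Metric.closedBall a.1.1 a.1.2, ENNReal.ofReal (f w) := by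
        refine ENNReal.tsum_le_tsum fun a => ?_
        have ha := hvt a.2
        rw [← ofReal_ballAvg_mul_volume hf h0 ha.2.1.1,
          volume_closedBall_eq _ (by linarith [ha.2.1.1] : 0 ≤ 5 * a.1.2),
          volume_closedBall_eq _ ha.2.1.1.le, mul_pow, ENNReal.ofReal_mul (by positivity),
          ENNReal.ofReal_pow (by norm_num), ENNReal.ofReal_ofNat]
        calc ENNReal.ofReal l * (5 ^ d * ENNReal.ofReal (a.1.2 ^ d) *
              volume (Metric.closedBall (0 : Space d) 1))
            ≤ ENNReal.ofReal (ballAvg f a.1.2 a.1.1) * (5 ^ d * ENNReal.ofReal (a.1.2 ^ d) *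
              volume (Metric.closedBall (0 : Space d) 1)) := by
              gcongr
              exact ha.2.2.le
          _ = _ := by ring
    _ = 5 ^ d * ∫⁻ w in ⋃ a ∈ v, Metric.closedBall a.1 a.2, ENNReal.ofReal (f w) := by
        rw [ENNReal.tsum_mul_left, lintegral_biUnion hcount
          (fun a _ => measurableSet_closedBall) hdisj]
    -- The centres lie in the cell, hence within `d + 1` of the origin, and the radii are at most
    -- `R`.
    _ ≤ 5 ^ d * ∫⁻ w in Metric.closedBall 0 (d + 1 + R), ENNReal.ofReal (f w) := by
        gcongr
        refine iUnion₂_subset fun a ha => Metric.closedBall_subset_closedBall' ?_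
        have h1 := norm_le_of_mem_cell (hvt ha).1
        have h2 := (hvt ha).2.1.2
        rw [dist_zero_right]
        linarith
    _ ≤ 5 ^ d * (N * ∫⁻ x in cell d, ENNReal.ofReal (f x)) := by
        gcongr
        exact hN _ fun i x => by simp only [hper i x]
    _ = _ := by push_cast; ring

/-- Jensen's inequality for `t ↦ t ^ q` on the unit ball. -/
lemma ballAvg_rpow_le {d : ℕ} {f : Space d → ℝ} (hf : Continuous f) (h0 : ∀ x, 0 ≤ f x) {q : ℝ}
    (hq : 1 ≤ q) (r : ℝ) (x : Space d) :
    ballAvg f r x ^ q ≤ ballAvg (fun y => f y ^ q) r x := by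
  have hc : Continuous fun w : Space d => f (x + r • w) := by fun_prop
  have hcq : Continuous fun w : Space d => f (x + r • w) ^ q :=
    hc.rpow_const fun _ => Or.inr (by linarith)
  have h := (convexOn_rpow hq).map_set_average_le (μ := (volume : Measure (Space d)))
    (t := Metric.closedBall (0 : Space d) 1) (f := fun w => f (x + r • w))
    (Real.continuous_rpow_const (by linarith)).continuousOn isClosed_Ici
    (Metric.measure_closedBall_pos _ _ one_pos).ne' measure_closedBall_lt_top.ne
    (Filter.Eventually.of_forall fun w => h0 _)
    (hc.continuousOn.integrableOn_compact (isCompact_closedBall _ _))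
    (hcq.continuousOn.integrableOn_compact (isCompact_closedBall _ _))
  simpa only [setAverage_eq, smul_eq_mul, ballAvg] using h

/-- By Jensen, a point where the maximal function of `f` exceeds `l` is one where that of `f ^ q`
exceeds `l ^ q`, so the weak `(1,1)` bound for `f ^ q` applies. -/
lemma exists_weakType_maximalFun_rpow (d : ℕ) {R : ℝ} (hR : 0 < R) {q : ℝ} (hq : 1 < q) :
    ∃ C : ℝ≥0, ∀ f : Space d → ℝ, Continuous f → (∀ x, 0 ≤ f x) → IsPeriodic f → ∀ l : ℝ, 0 ≤ l →
      ENNReal.ofReal (l ^ q) * volume {x ∈ cell d | l < maximalFun R f x} ≤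
        C * (eLpNorm f (ENNReal.ofReal q) (volume.restrict (cell d))) ^ q := by
  obtain ⟨C, hC⟩ := exists_weakType_maximalFun d hR
  have hq0 : 0 < q := by linarith
  refine ⟨C, fun f hf h0 hper l hl => ?_⟩
  have hfq : Continuous fun x => f x ^ q := hf.rpow_const fun _ => Or.inr hq0.le
  have h := hC (fun x => f x ^ q) hfq (fun x => Real.rpow_nonneg (h0 x) _)
    (fun i x => by simp only [hper i x]) (l ^ q)
  have hn : (eLpNorm f (ENNReal.ofReal q) (volume.restrict (cell d))) ^ q =
      ∫⁻ x in cell d, ENNReal.ofReal (f x ^ q) := by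
    rw [eLpNorm_eq_lintegral_rpow_enorm_toReal (by simpa using hq0) ENNReal.ofReal_ne_top,
      ENNReal.toReal_ofReal hq0.le, ← ENNReal.rpow_mul, one_div, inv_mul_cancel₀ hq0.ne',
      ENNReal.rpow_one]
    refine lintegral_congr fun x => ?_
    rw [Real.enorm_of_nonneg (h0 x), ENNReal.ofReal_rpow_of_nonneg (h0 x) hq0.le]
  rw [hn]
  refine le_trans ?_ h
  refine mul_le_mul' le_rfl (measure_mono fun x hx => ⟨hx.1, ?_⟩)
  have hlt := hx.2
  obtain ⟨r, hr, hlr⟩ := exists_radius_of_lt_maximalFun hR hf hlt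
  calc l ^ q < ballAvg f r _ ^ q := Real.rpow_lt_rpow hl hlr hq0
    _ ≤ ballAvg (fun y => f y ^ q) r _ := ballAvg_rpow_le hf h0 hq.le _ _
    _ ≤ _ := ballAvg_le_maximalFun hfq ⟨hr.1.le, hr.2⟩ _

/-- The maximal operator is bounded from `L^q` to `L¹` of the period cell, for `q > 1`. -/
lemma exists_lintegral_maximalFun_le (d : ℕ) {R : ℝ} (hR : 0 < R) {q : ℝ} (hq : 1 < q) :
    ∃ C : ℝ≥0, ∀ f : Space d → ℝ, Continuous f → (∀ x, 0 ≤ f x) → IsPeriodic f →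
      ∫⁻ x in cell d, ENNReal.ofReal (maximalFun R f x) ≤
        C * eLpNorm f (ENNReal.ofReal q) (volume.restrict (cell d)) := by
  obtain ⟨C, hC⟩ := exists_weakType_maximalFun_rpow d hR hq
  have hq0 : 0 < q := by linarith
  refine ⟨1 + C * (q - 1).toNNReal⁻¹, fun f hf h0 hper => ?_⟩
  set F := eLpNorm f (ENNReal.ofReal q) (volume.restrict (cell d)) with hF
  -- Layer-cake formula, split at height `a`. Below `a` the superlevel sets have measure at most
  -- `1`, which contributes `a`; above `a` the weak-type bound contributes `C F ^ q a ^ (1 - q) / (q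
  -- - 1)`, at most `C a / (q - 1)`. Taking `a > F` and letting `a` decrease to `F` also covers `F =
  -- 0` and `F = ∞`.
  have key : ∀ a : ℝ≥0, F < a → ∫⁻ x in cell d, ENNReal.ofReal (maximalFun R f x) ≤
      ((1 + C * (q - 1).toNNReal⁻¹ : ℝ≥0) : ℝ≥0∞) * a := by
    intro a ha
    have ha0 : (0 : ℝ) < a := by
      have : (0 : ℝ≥0∞) < a := ha.pos
      exact_mod_cast this
    rw [lintegral_eq_lintegral_meas_lt _
      (Filter.Eventually.of_forall fun x => maximalFun_nonneg h0 x)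
      (continuous_maximalFun R hf).aemeasurable, ← Ioc_union_Ioi_eq_Ioi ha0.le]
    have hmeas : ∀ l : ℝ, volume.restrict (cell d) {x | l < maximalFun R f x} =
        volume {x ∈ cell d | l < maximalFun R f x} := by
      intro l
      rw [Measure.restrict_apply' (measurableSet_cell d)]
      congr 1
      ext x
      simp [and_comm]
    calc ∫⁻ l in Ioc 0 (a : ℝ) ∪ Ioi (a : ℝ),
            volume.restrict (cell d) {x | l < maximalFun R f x}
        ≤ (∫⁻ l in Ioc 0 (a : ℝ), volume.restrict (cell d) {x | l < maximalFun R f x}) +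
          ∫⁻ l in Ioi (a : ℝ), volume.restrict (cell d) {x | l < maximalFun R f x} :=
          lintegral_union_le _ _ _
      _ ≤ (∫⁻ _l in Ioc 0 (a : ℝ), 1) +
          ∫⁻ l in Ioi (a : ℝ), C * F ^ q * ENNReal.ofReal (l ^ (-q)) := by
          gcongr ?_ + ?_
          · exact lintegral_mono fun l => prob_le_one
          · refine setLIntegral_mono' measurableSet_Ioi fun l hl => ?_
            have hl0 : 0 < l := ha0.trans hl
            rw [hmeas]
            have h1 := hC f hf h0 hper l hl0.le
            calc volume {x ∈ cell d | l < maximalFun R f x}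
                = ENNReal.ofReal (l ^ (-q)) * (ENNReal.ofReal (l ^ q) *
                    volume {x ∈ cell d | l < maximalFun R f x}) := by
                  rw [← mul_assoc, ← ENNReal.ofReal_mul (by positivity), ← Real.rpow_add hl0]
                  simp
              _ ≤ ENNReal.ofReal (l ^ (-q)) * (C * F ^ q) := by gcongr
              _ = _ := mul_comm _ _
      _ = a + C * F ^ q * ENNReal.ofReal ((a : ℝ) ^ (1 - q) / (q - 1)) := by
          congr 1
          · simp
          · rw [lintegral_const_mul' _ _ (by
                refine ENNReal.mul_ne_top ENNReal.coe_ne_top ?_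
                exact ENNReal.rpow_ne_top_of_nonneg hq0.le ha.ne_top),
              ← ofReal_integral_eq_lintegral_ofReal
                (integrableOn_Ioi_rpow_of_lt (by linarith) ha0)
                ((ae_restrict_mem measurableSet_Ioi).mono fun l hl =>
                  Real.rpow_nonneg (ha0.le.trans (le_of_lt hl)) _),
              integral_Ioi_rpow_of_lt (by linarith) ha0]
            congr 2
            rw [show -q + 1 = -(q - 1) by ring, show 1 - q = -(q - 1) by ring, neg_div_neg_eq]
      _ ≤ a + C * (a : ℝ≥0∞) ^ q * ENNReal.ofReal ((a : ℝ) ^ (1 - q) / (q - 1)) := by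
          gcongr
      _ = ((1 + C * (q - 1).toNNReal⁻¹ : ℝ≥0) : ℝ≥0∞) * a := by
          have e1 : (a : ℝ≥0∞) ^ q * ENNReal.ofReal ((a : ℝ) ^ (1 - q) / (q - 1)) =
              (((q - 1).toNNReal⁻¹ : ℝ≥0) : ℝ≥0∞) * a := by
            rw [← ENNReal.ofReal_coe_nnreal (p := a),
              ENNReal.ofReal_rpow_of_nonneg ha0.le hq0.le, ← ENNReal.ofReal_mul (by positivity),
              ← ENNReal.ofReal_coe_nnreal (p := (q - 1).toNNReal⁻¹),
              ← ENNReal.ofReal_mul (by positivity)]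
            congr 1
            rw [NNReal.coe_inv, Real.coe_toNNReal _ (by linarith), mul_div_assoc',
              ← Real.rpow_add ha0, show q + (1 - q) = 1 by ring, Real.rpow_one]
            ring
          rw [mul_assoc, e1]
          push_cast
          ring
  have hD : ((1 + C * (q - 1).toNNReal⁻¹ : ℝ≥0) : ℝ≥0∞) ≠ 0 := by
    have : (1 + C * (q - 1).toNNReal⁻¹ : ℝ≥0) ≠ 0 := by positivity
    exact_mod_cast this
  rw [mul_comm, ← ENNReal.div_le_iff hD ENNReal.coe_ne_top]
  refine le_of_forall_gt_imp_ge_of_dense fun b hb => ?_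
  induction b with
  | top => exact le_top
  | coe b =>
    rw [ENNReal.div_le_iff hD ENNReal.coe_ne_top, mul_comm]
    exact key b hb

/-! ### Difference quotients and the maximal function of the gradient -/

lemma norm_sub_le_integral_segment {d : ℕ} {u : Space d → Space d}
    {G : Space d → Space d →L[ℝ] Space d} (hu : ∀ x, HasFDerivAt u (G x) x) (hG : Continuous G)
    (x z : Space d) :
    ‖u x - u z‖ ≤ ‖z - x‖ * ∫ s in Ioc (0 : ℝ) 1, ‖G (x + s • (z - x))‖ := by
  have hline : ∀ s : ℝ, HasDerivAt (fun s : ℝ => x + s • (z - x)) (z - x) s := fun s => by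
    simpa using ((hasDerivAt_id s).smul_const (z - x)).const_add x
  have hderiv : ∀ s : ℝ, HasDerivAt (fun s : ℝ => u (x + s • (z - x)))
      (G (x + s • (z - x)) (z - x)) s := fun s => (hu _).comp_hasDerivAt s (hline s)
  have hc : Continuous fun s : ℝ => G (x + s • (z - x)) := by fun_prop
  have h := intervalIntegral.integral_eq_sub_of_hasDerivAt (a := 0) (b := 1)
    (fun s _ => hderiv s) ((hc.clm_apply continuous_const).intervalIntegrable _ _)
  simp only [one_smul, add_sub_cancel, zero_smul, add_zero] at h
  rw [norm_sub_rev, ← h, intervalIntegral.integral_of_le zero_le_one, ← integral_const_mul]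
  refine norm_integral_le_of_norm_le ?_ ?_
  · exact ((hc.norm.const_mul _).continuousOn.integrableOn_compact isCompact_Icc).mono_set
      Ioc_subset_Icc_self
  · refine Filter.Eventually.of_forall fun s => ?_
    rw [mul_comm]
    exact ContinuousLinearMap.le_opNorm _ _

/-- The segment estimate is integrated over `z` in a ball that lies within `r` of `x`. For fixed
`s`, the substitution `w = x + s (z - x)` maps this ball into the ball of radius `s r` about `x`;
its Jacobian `s ^ (-d)` cancels against the volume of that ball, leaving `r ^ d` times an average
bounded by the maximal function at `x`. -/
lemma integral_norm_sub_le_maximalFun {d : ℕ} {u : Space d → Space d}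
    {G : Space d → Space d →L[ℝ] Space d} (hu : ∀ x, HasFDerivAt u (G x) x) (hG : Continuous G)
    {x m : Space d} {r R : ℝ} (hr : 0 < r) (hrR : r ≤ R) (hxm : dist m x ≤ r / 2) :
    ∫ z in Metric.closedBall m (r / 2), ‖u x - u z‖ ≤
      volume.real (Metric.closedBall (0 : Space d) 1) * r ^ d *
        (r * maximalFun R (fun y => ‖G y‖) x) := by
  have hucont : Continuous u := continuous_iff_continuousAt.2 fun x => (hu x).continuousAt
  have hgc : Continuous fun y => ‖G y‖ := hG.norm
  set β := volume.real (Metric.closedBall (0 : Space d) 1) with hβ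
  have hβ0 : 0 < β := volume_real_unitBall_pos d
  set B := Metric.closedBall m (r / 2) with hB
  have hBc : IsCompact B := isCompact_closedBall _ _
  have hjoint : Continuous fun q : Space d × ℝ => ‖G (x + q.2 • (q.1 - x))‖ := by fun_prop
  have hint : Integrable (fun q : Space d × ℝ => ‖G (x + q.2 • (q.1 - x))‖)
      ((volume.restrict B).prod (volume.restrict (Ioc (0 : ℝ) 1))) := by
    rw [Measure.prod_restrict]
    exact (hjoint.continuousOn.integrableOn_compact (hBc.prod isCompact_Icc)).mono_set
      (prod_mono le_rfl Ioc_subset_Icc_self)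
  have hslice : ∀ s ∈ Ioc (0 : ℝ) 1, ∫ z in B, ‖G (x + s • (z - x))‖ ≤
      β * r ^ d * maximalFun R (fun y => ‖G y‖) x := by
    intro s hs
    have hsr : 0 < s * r := mul_pos hs.1 hr
    have e : ∀ z, x + s • (z - x) = (x - s • x) + s • z := fun z => by
      rw [smul_sub]; abel
    simp only [e]
    rw [setIntegral_smul_add (fun y => ‖G y‖) hs.1 _ _ _ (by linarith)]
    have hsub : Metric.closedBall (x - s • x + s • m) (s * (r / 2)) ⊆
        Metric.closedBall x (s * r) := by
      refine Metric.closedBall_subset_closedBall' ?_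
      have : x - s • x + s • m - x = s • (m - x) := by rw [smul_sub]; abel
      rw [dist_eq_norm, this, norm_smul, Real.norm_of_nonneg hs.1.le, ← dist_eq_norm]
      nlinarith [hs.1]
    calc (s ^ d)⁻¹ * ∫ w in Metric.closedBall (x - s • x + s • m) (s * (r / 2)), ‖G w‖
        ≤ (s ^ d)⁻¹ * ∫ w in Metric.closedBall x (s * r), ‖G w‖ := by
          have := hs.1
          refine mul_le_mul_of_nonneg_left ?_ (by positivity)
          refine setIntegral_mono_set (μ := volume)
            (hgc.continuousOn.integrableOn_compact (isCompact_closedBall _ _))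
            (Filter.Eventually.of_forall fun _ => norm_nonneg _) hsub.eventuallyLE
      _ = β * r ^ d * ballAvg (fun y => ‖G y‖) (s * r) x := by
          rw [ballAvg_eq _ hsr, mul_pow, ← hβ]
          have := hs.1
          field_simp
      _ ≤ _ := by
          gcongr
          refine ballAvg_le_maximalFun hgc ⟨hsr.le, ?_⟩ x
          nlinarith [hs.2]
  calc ∫ z in B, ‖u x - u z‖
      ≤ ∫ z in B, r * ∫ s in Ioc (0 : ℝ) 1, ‖G (x + s • (z - x))‖ := by
        refine setIntegral_mono_on ?_ ?_ measurableSet_closedBall fun z hz => ?_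
        · exact (continuous_const.sub hucont).norm.continuousOn.integrableOn_compact hBc
        · exact (hint.integral_prod_left).const_mul r
        · refine (norm_sub_le_integral_segment hu hG x z).trans ?_
          gcongr
          rw [← dist_eq_norm]
          have := dist_triangle z m x
          have := Metric.mem_closedBall.1 hz
          linarith
    _ = r * ∫ s in Ioc (0 : ℝ) 1, ∫ z in B, ‖G (x + s • (z - x))‖ := by
        rw [integral_const_mul, integral_integral_swap hint]
    _ ≤ r * ∫ _s in Ioc (0 : ℝ) 1, β * r ^ d * maximalFun R (fun y => ‖G y‖) x := by
        refine mul_le_mul_of_nonneg_left ?_ hr.le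
        refine setIntegral_mono_on hint.integral_prod_right ?_ measurableSet_Ioc hslice
        exact integrableOn_const (by simp)
    _ = _ := by
        simp
        ring

/-- The pointwise estimate of difference quotients by the maximal function of the gradient. -/
lemma norm_sub_le_maximalFun {d : ℕ} {u : Space d → Space d}
    {G : Space d → Space d →L[ℝ] Space d} (hu : ∀ x, HasFDerivAt u (G x) x) (hG : Continuous G)
    {x y : Space d} {R : ℝ} (hR : ‖x - y‖ ≤ R) :
    ‖u x - u y‖ ≤ 2 ^ d * (‖x - y‖ *
      (maximalFun R (fun z => ‖G z‖) x + maximalFun R (fun z => ‖G z‖) y)) := by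
  rcases eq_or_ne x y with rfl | hxy
  · simp
  have hucont : Continuous u := continuous_iff_continuousAt.2 fun x => (hu x).continuousAt
  set r := ‖x - y‖ with hr
  have hr0 : 0 < r := norm_pos_iff.2 (sub_ne_zero.2 hxy)
  -- The ball of radius `r / 2` about the midpoint lies within `r` of both points, so `u x` and `u
  -- y` can both be compared with `u z` for `z` in it. Its volume is `2 ^ (-d)` times that of a ball
  -- of radius `r`, whence the factor `2 ^ d`.
  set m := midpoint ℝ x y with hm
  have hx : dist m x ≤ r / 2 := by
    rw [dist_midpoint_left, dist_eq_norm]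
    simp
    linarith
  have hy : dist m y ≤ r / 2 := by
    rw [dist_midpoint_right, dist_eq_norm]
    simp
    linarith
  have h1 := integral_norm_sub_le_maximalFun hu hG hr0 hR hx
  have h2 := integral_norm_sub_le_maximalFun hu hG hr0 hR hy
  set β := volume.real (Metric.closedBall (0 : Space d) 1) with hβ
  have hβ0 : 0 < β := volume_real_unitBall_pos d
  have hvol : volume.real (Metric.closedBall m (r / 2)) = (r / 2) ^ d * β := by
    rw [measureReal_def, volume_closedBall_eq m (by positivity), ENNReal.toReal_mul,
      ENNReal.toReal_ofReal (by positivity), hβ, measureReal_def]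
  have hcx : IntegrableOn (fun z => ‖u x - u z‖) (Metric.closedBall m (r / 2)) :=
    (continuous_const.sub hucont).norm.continuousOn.integrableOn_compact (isCompact_closedBall _ _)
  have hcy : IntegrableOn (fun z => ‖u y - u z‖) (Metric.closedBall m (r / 2)) :=
    (continuous_const.sub hucont).norm.continuousOn.integrableOn_compact (isCompact_closedBall _ _)
  have h3 : (r / 2) ^ d * β * ‖u x - u y‖ ≤
      ∫ z in Metric.closedBall m (r / 2), (‖u x - u z‖ + ‖u y - u z‖) := by
    rw [← hvol, ← smul_eq_mul, ← setIntegral_const]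
    refine setIntegral_mono_on (integrableOn_const measure_closedBall_lt_top.ne) (hcx.add hcy)
      measurableSet_closedBall fun z _ => ?_
    rw [norm_sub_rev (u y)]
    exact norm_sub_le_norm_sub_add_norm_sub _ _ _
  rw [integral_add hcx hcy] at h3
  have hp : 0 < (r / 2) ^ d * β := by positivity
  refine le_of_mul_le_mul_left (h3.trans (add_le_add h1 h2) |>.trans (le_of_eq ?_)) hp
  rw [div_pow]
  field_simp

/-- Points farther apart than the radius cutoff are first brought closer by a lattice translation,
which changes neither `u` nor the maximal function. -/
lemma norm_sub_le_maximalFun_of_isPeriodic {d : ℕ} {u : Space d → Space d} (hper : IsPeriodic u)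
    {G : Space d → Space d →L[ℝ] Space d} (hu : ∀ x, HasFDerivAt u (G x) x) (hG : Continuous G)
    (hGper : IsPeriodic G) (x y : Space d) :
    ‖u x - u y‖ ≤ 2 ^ d * (‖x - y‖ *
      (maximalFun (d + 1) (fun z => ‖G z‖) x + maximalFun (d + 1) (fun z => ‖G z‖) y)) := by
  by_cases h : ‖x - y‖ ≤ d + 1
  · exact norm_sub_le_maximalFun hu hG h
  · push Not at h
    obtain ⟨k, hk⟩ := exists_norm_add_latticeVec_le (x - y)
    have e : x - y + latticeVec k = x + latticeVec k - y := by abel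
    rw [e] at hk
    have hMper : IsPeriodic (maximalFun (d + 1) fun z => ‖G z‖) :=
      isPeriodic_maximalFun fun i z => by simp only [hGper i z]
    have h1 := norm_sub_le_maximalFun hu hG hk
    rw [hper.add_latticeVec, hMper.add_latticeVec] at h1
    refine h1.trans ?_
    have := maximalFun_nonneg (R := d + 1) (fun z => norm_nonneg (G z)) x
    have := maximalFun_nonneg (R := d + 1) (fun z => norm_nonneg (G z)) y
    have := hk.trans h.le
    gcongr

/-! ### Global flows of bounded Lipschitz fields -/

/-- `θ` is the global flow of the autonomous vector field `w`. -/
structure IsFlow {E : Type*} [NormedAddCommGroup E] [NormedSpace ℝ E] (w : E → E)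
    (θ : ℝ → E → E) : Prop where
  zero : ∀ z, θ 0 z = z
  hasDerivAt : ∀ z t, HasDerivAt (fun s => θ s z) (w (θ t z)) t

section Flow

variable {E : Type*} [NormedAddCommGroup E] [NormedSpace ℝ E] {w : E → E} {θ : ℝ → E → E}
  {K B : ℝ≥0}

/-- A bounded field cannot leave the ball of radius `B (n + 1)` within time `n + 1`, so
Picard–Lindelöf applies on every bounded interval; uniqueness glues the pieces. -/
lemma exists_integralCurve [CompleteSpace E] (hw : LipschitzWith K w) (hB : ∀ z, ‖w z‖ ≤ B)
    (z : E) : ∃ γ : ℝ → E, γ 0 = z ∧ ∀ t, HasDerivAt γ (w (γ t)) t := by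
  have loc : ∀ n : ℕ, ∃ γ : ℝ → E, γ 0 = z ∧
      ∀ t ∈ Ioo (-((n : ℝ) + 1)) (n + 1), HasDerivAt γ (w (γ t)) t := by
    intro n
    have h0 : (0 : ℝ) ∈ Icc (-((n : ℝ) + 1)) (n + 1) := by constructor <;> linarith
    have hPL : IsPicardLindelof (fun _ => w) (⟨0, h0⟩ : Icc (-((n : ℝ) + 1)) (n + 1)) z
        (B * (n + 1)) 0 B K :=
      { lipschitzOnWith := fun _ _ => hw.lipschitzOnWith
        continuousOn := fun _ _ => continuousOn_const
        norm_le := fun _ _ x _ => hB x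
        mul_max_le := by simp }
    obtain ⟨γ, hγ0, hγ⟩ := hPL.exists_eq_forall_mem_Icc_hasDerivWithinAt₀
    exact ⟨γ, hγ0, fun t ht => (hγ t (Ioo_subset_Icc_self ht)).hasDerivAt (Icc_mem_nhds ht.1 ht.2)⟩
  choose γ hγ0 hγ using loc
  have agree : ∀ m n : ℕ, m ≤ n → ∀ t ∈ Ioo (-((m : ℝ) + 1)) (m + 1), γ m t = γ n t := by
    intro m n hmn t ht
    have hmn' : (m : ℝ) ≤ n := by exact_mod_cast hmn
    refine ODE_solution_unique_of_mem_Ioo (v := fun _ => w) (s := fun _ => univ) (K := K) (t₀ := 0)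
      (fun _ _ => hw.lipschitzOnWith) ?_ (fun s hs => ⟨hγ m s hs, trivial⟩)
      (fun s hs => ⟨hγ n s ?_, trivial⟩) ((hγ0 m).trans (hγ0 n).symm) ht
    · constructor <;> linarith [(Nat.cast_nonneg m : (0 : ℝ) ≤ m)]
    · exact ⟨by linarith [hs.1], by linarith [hs.2]⟩
  have glue : ∀ n : ℕ, ∀ t ∈ Ioo (-((n : ℝ) + 1)) (n + 1), γ ⌈|t|⌉₊ t = γ n t := by
    intro n t ht
    rcases le_total ⌈|t|⌉₊ n with h | h
    · refine agree _ _ h t ?_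
      have := Nat.le_ceil |t|
      exact abs_lt.1 (this.trans_lt (lt_add_one _))
    · exact (agree _ _ h t ht).symm
  refine ⟨fun t => γ ⌈|t|⌉₊ t, by simp [hγ0], fun t => ?_⟩
  have ht : t ∈ Ioo (-((⌈|t|⌉₊ : ℝ) + 1)) (⌈|t|⌉₊ + 1) :=
    abs_lt.1 ((Nat.le_ceil |t|).trans_lt (lt_add_one _))
  refine (hγ _ t ht).congr_of_eventuallyEq ?_
  filter_upwards [Ioo_mem_nhds ht.1 ht.2] with s hs
  exact glue _ s hs

lemma exists_isFlow [CompleteSpace E] (hw : LipschitzWith K w) (hB : ∀ z, ‖w z‖ ≤ B) :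
    ∃ θ : ℝ → E → E, IsFlow w θ := by
  choose γ h0 h1 using exists_integralCurve hw hB
  exact ⟨fun t z => γ z t, h0, h1⟩

namespace IsFlow

lemma eq_of_integralCurve (hθ : IsFlow w θ) (hw : LipschitzWith K w) {γ : ℝ → E}
    (hγ : ∀ t, HasDerivAt γ (w (γ t)) t) (t : ℝ) : γ t = θ t (γ 0) :=
  congrFun (ODE_solution_unique_univ (v := fun _ => w) (s := fun _ => univ) (t₀ := 0)
    (fun _ => hw.lipschitzOnWith) (fun t => ⟨hγ t, trivial⟩)
    (fun t => ⟨hθ.hasDerivAt (γ 0) t, trivial⟩) (hθ.zero _).symm) t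

lemma map_add (hθ : IsFlow w θ) (hw : LipschitzWith K w) (s t : ℝ) (z : E) :
    θ (s + t) z = θ s (θ t z) := by
  have h := hθ.eq_of_integralCurve hw (γ := fun s => θ (s + t) z)
    (fun s => (hθ.hasDerivAt z (s + t)).comp_add_const s t) s
  simpa using h

lemma neg (hθ : IsFlow w θ) : IsFlow (fun z => -w z) (fun t => θ (-t)) where
  zero z := by simp [hθ.zero]
  hasDerivAt z t := by
    simpa [Function.comp_def] using (hθ.hasDerivAt z (-t)).scomp t (hasDerivAt_neg t)

lemma dist_le_of_nonneg (hθ : IsFlow w θ) (hw : LipschitzWith K w) {t : ℝ} (ht : 0 ≤ t) (x y : E) :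
    dist (θ t x) (θ t y) ≤ dist x y * Real.exp (K * t) := by
  have h := dist_le_of_trajectories_ODE (v := fun _ => w) (K := K) (a := 0) (b := t)
    (f := fun s => θ s x) (g := fun s => θ s y) (δ := dist x y) (fun _ => hw)
    (fun s _ => (hθ.hasDerivAt x s).continuousAt.continuousWithinAt)
    (fun s _ => (hθ.hasDerivAt x s).hasDerivWithinAt)
    (fun s _ => (hθ.hasDerivAt y s).continuousAt.continuousWithinAt)
    (fun s _ => (hθ.hasDerivAt y s).hasDerivWithinAt) (by simp [hθ.zero]) t ⟨ht, le_rfl⟩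
  simpa using h

lemma dist_le (hθ : IsFlow w θ) (hw : LipschitzWith K w) (t : ℝ) (x y : E) :
    dist (θ t x) (θ t y) ≤ dist x y * Real.exp (K * |t|) := by
  rcases le_total 0 t with ht | ht
  · rw [abs_of_nonneg ht]
    exact hθ.dist_le_of_nonneg hw ht x y
  · rw [abs_of_nonpos ht]
    have h := hθ.neg.dist_le_of_nonneg (K := K)
      (LipschitzWith.of_dist_le_mul fun a b => by simpa using hw.dist_le_mul a b)
      (neg_nonneg.2 ht) x y
    simpa using h

lemma norm_sub_le (hθ : IsFlow w θ) (hB : ∀ z, ‖w z‖ ≤ B) (s t : ℝ) (z : E) :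
    ‖θ s z - θ t z‖ ≤ B * |s - t| :=
  convex_univ.norm_image_sub_le_of_norm_hasDerivWithin_le (f := fun s => θ s z)
    (fun r _ => (hθ.hasDerivAt z r).hasDerivWithinAt) (fun _ _ => hB _) (mem_univ t) (mem_univ s)

/-- The second-order error of an Euler step. Only the Lipschitz bound on `w` is needed: along the
curve, `w` differs from `w z` by at most `K B |h|`. -/
lemma norm_sub_sub_smul_le (hθ : IsFlow w θ) (hw : LipschitzWith K w) (hB : ∀ z, ‖w z‖ ≤ B)
    (h : ℝ) (z : E) : ‖θ h z - (z + h • w z)‖ ≤ K * B * h ^ 2 := by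
  have key := (convex_uIcc (0 : ℝ) h).norm_image_sub_le_of_norm_hasDerivWithin_le
    (f := fun s => θ s z - s • w z) (f' := fun s => w (θ s z) - w z) (C := K * (B * |h|))
    (fun r _ => by
      simpa using ((hθ.hasDerivAt z r).fun_sub
        ((hasDerivAt_id r).smul_const (w z))).hasDerivWithinAt)
    (fun r hr => by
      rw [← dist_eq_norm]
      refine (hw.dist_le_mul _ _).trans ?_
      gcongr
      have h1 := hθ.norm_sub_le hB r 0 z
      rw [hθ.zero, sub_zero] at h1
      rw [dist_eq_norm]
      refine h1.trans ?_
      refine mul_le_mul_of_nonneg_left ?_ B.2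
      simpa using abs_sub_left_of_mem_uIcc hr)
    left_mem_uIcc right_mem_uIcc
  simp only [hθ.zero, zero_smul, sub_zero, Real.norm_eq_abs] at key
  calc ‖θ h z - (z + h • w z)‖ = ‖θ h z - h • w z - z‖ := by congr 1; abel
    _ ≤ K * (B * |h|) * |h| := key
    _ = K * B * h ^ 2 := by rw [← sq_abs h]; ring

lemma map_add_of_periodic (hθ : IsFlow w θ) (hw : LipschitzWith K w) {c : E}
    (hc : ∀ z, w (z + c) = w z) (t : ℝ) (z : E) : θ t (z + c) = θ t z + c := by
  have h := hθ.eq_of_integralCurve hw (γ := fun s => θ s z + c)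
    (fun s => by rw [hc]; exact (hθ.hasDerivAt z s).add_const c) t
  simpa [hθ.zero] using h.symm

lemma continuous_uncurry (hθ : IsFlow w θ) (hw : LipschitzWith K w) (hB : ∀ z, ‖w z‖ ≤ B) :
    Continuous fun q : ℝ × E => θ q.1 q.2 := by
  rw [continuous_iff_continuousAt]
  rintro ⟨t, z⟩
  rw [ContinuousAt, tendsto_iff_dist_tendsto_zero]
  have hlim : Filter.Tendsto (fun q : ℝ × E => B * |q.1 - t| + dist q.2 z * Real.exp (K * |t|))
      (nhds (t, z)) (nhds 0) := by
    have hc : Continuous fun q : ℝ × E => B * |q.1 - t| + dist q.2 z * Real.exp (K * |t|) := by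
      fun_prop
    simpa using hc.tendsto (t, z)
  refine squeeze_zero (fun _ => dist_nonneg) (fun q => ?_) hlim
  refine (dist_triangle _ (θ t q.2) _).trans (add_le_add ?_ (hθ.dist_le hw _ _ _))
  rw [dist_eq_norm]
  exact hθ.norm_sub_le hB _ _ _

end IsFlow

end Flow

/-! ### Mollification -/

section Mollify

variable {E : Type*} [NormedAddCommGroup E] [NormedSpace ℝ E] [FiniteDimensional ℝ E]
  [MeasurableSpace E] (μ : Measure E)

/-- The mollification of `f` by the normalized bump function `φ`. -/
def mollify (φ : ContDiffBump (0 : E)) (f : E → ℝ) (z : E) : ℝ :=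
  ∫ y, φ.normed μ y * f (z - y) ∂μ

variable {μ} {φ : ContDiffBump (0 : E)} {f : E → ℝ}

lemma mollify_add_of_periodic {c : E} (hc : ∀ z, f (z + c) = f z) (z : E) :
    mollify μ φ f (z + c) = mollify μ φ f z := by
  unfold mollify
  simp only [add_sub_right_comm, hc]

variable [BorelSpace E] [μ.IsAddHaarMeasure]

lemma contDiff_mollify (hf : Continuous f) : ContDiff ℝ ∞ (mollify μ φ f) :=
  φ.hasCompactSupport_normed.contDiff_convolution_left (ContinuousLinearMap.lsmul ℝ ℝ)
    (φ.contDiff_normed (n := ⊤)) hf.locallyIntegrable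

lemma integrable_normed_mul (hf : Continuous f) (z : E) :
    Integrable (fun y => φ.normed μ y * f (z - y)) μ :=
  Continuous.integrable_of_hasCompactSupport
    (φ.continuous_normed.mul (by fun_prop)) φ.hasCompactSupport_normed.mul_right

lemma abs_integral_normed_mul_le {g : E → ℝ} {M : ℝ}
    (hg : ∀ y ∈ Metric.ball (0 : E) φ.rOut, |g y| ≤ M) :
    |∫ y, φ.normed μ y * g y ∂μ| ≤ M := by
  have h := norm_integral_le_of_norm_le (μ := μ) (f := fun y => φ.normed μ y * g y)
    (g := fun y => φ.normed μ y * M) (φ.integrable_normed.mul_const M)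
    (Filter.Eventually.of_forall fun y => by
      rw [norm_mul, Real.norm_of_nonneg (φ.nonneg_normed y), Real.norm_eq_abs]
      by_cases hy : y ∈ Metric.ball (0 : E) φ.rOut
      · exact mul_le_mul_of_nonneg_left (hg y hy) (φ.nonneg_normed y)
      · rw [← φ.support_normed_eq (μ := μ), Function.notMem_support] at hy
        simp [hy])
  rwa [integral_mul_const, φ.integral_normed, one_mul, Real.norm_eq_abs] at h

lemma abs_mollify_sub_le (hf : Continuous f) {z : E} {M : ℝ}
    (h : ∀ y ∈ Metric.ball z φ.rOut, |f y - f z| ≤ M) : |mollify μ φ f z - f z| ≤ M := by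
  have e : mollify μ φ f z - f z = ∫ y, φ.normed μ y * (f (z - y) - f z) ∂μ := by
    simp only [mul_sub]
    rw [integral_sub (integrable_normed_mul hf z) (φ.integrable_normed.mul_const _),
      integral_mul_const, φ.integral_normed, one_mul, mollify]
  rw [e]
  refine abs_integral_normed_mul_le fun y hy => h _ ?_
  simpa [dist_eq_norm] using hy

/-- The difference quotient of the mollification is an average of difference quotients of `f` over
the ball, all in the same direction `v`, so `f` need not be differentiable. The term `C * h`
disappears in the limit. -/
lemma abs_fderiv_mollify_le (hf : Continuous f) {z v : E} {D C : ℝ} {h₀ : ℝ} (hh₀ : 0 < h₀)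
    (hD : ∀ y ∈ Metric.ball z φ.rOut, ∀ h ∈ Ioo 0 h₀, |f (y + h • v) - f y| ≤ h * (D + C * h)) :
    |fderiv ℝ (mollify μ φ f) z v| ≤ D := by
  have hdiff : HasFDerivAt (mollify μ φ f) (fderiv ℝ (mollify μ φ f) z) z :=
    ((contDiff_mollify hf).differentiable (by simp) z).hasFDerivAt
  have hline : HasDerivAt (fun h : ℝ => z + h • v) v 0 := by
    simpa using ((hasDerivAt_id (0 : ℝ)).smul_const v).const_add z
  have hderiv : HasDerivAt (fun h : ℝ => mollify μ φ f (z + h • v))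
      (fderiv ℝ (mollify μ φ f) z v) 0 := by
    have h1 : HasFDerivAt (mollify μ φ f) (fderiv ℝ (mollify μ φ f) z) (z + (0 : ℝ) • v) := by
      simpa using hdiff
    exact h1.comp_hasDerivAt 0 hline
  have hlim := hderiv.tendsto_slope_zero_right.abs
  have hlim2 : Filter.Tendsto (fun h : ℝ => D + C * h) (nhdsWithin 0 (Ioi 0)) (nhds D) := by
    have hc : Continuous fun h : ℝ => D + C * h := by fun_prop
    simpa using (hc.tendsto 0).mono_left nhdsWithin_le_nhds
  refine le_of_tendsto_of_tendsto hlim hlim2 ?_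
  filter_upwards [Ioo_mem_nhdsGT hh₀] with h hh
  have e : mollify μ φ f (z + h • v) - mollify μ φ f z =
      ∫ y, φ.normed μ y * (f (z - y + h • v) - f (z - y)) ∂μ := by
    unfold mollify
    rw [← integral_sub (integrable_normed_mul hf _) (integrable_normed_mul hf _)]
    refine integral_congr_ae (Filter.Eventually.of_forall fun y => ?_)
    simp only [mul_sub, add_sub_right_comm]
  rw [zero_add, zero_smul, add_zero, smul_eq_mul, abs_mul, abs_inv, abs_of_pos hh.1,
    inv_mul_le_iff₀ hh.1, e]
  refine abs_integral_normed_mul_le fun y hy => hD _ ?_ h hh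
  simpa [dist_eq_norm] using hy

end Mollify

/-! ### Transport of weak solutions by the space-time flow -/

/-- `v` is a Lipschitz, bounded, spatially periodic extension to all times of the velocity field
`u` on the time interval `[0, T]`. -/
structure IsLipschitzExtension {d : ℕ} (T : ℝ) (u : ℝ → Space d → Space d)
    (v : ℝ × Space d → Space d) (K B : ℝ≥0) : Prop where
  lipschitz : LipschitzWith K v
  norm_le : ∀ z, ‖v z‖ ≤ B
  periodic : ∀ z k, v (z + (0, latticeVec k)) = v z
  eq : ∀ t ∈ Icc 0 T, ∀ x, v (t, x) = u t x

/-- The autonomous field `(1, v)` on space-time. -/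
def spaceTimeField {d : ℕ} (v : ℝ × Space d → Space d) (z : ℝ × Space d) : ℝ × Space d :=
  (1, v z)

section Transport

variable {d : ℕ} {T : ℝ} {u : ℝ → Space d → Space d} {v : ℝ × Space d → Space d} {K B : ℝ≥0}
  {θ : ℝ → ℝ × Space d → ℝ × Space d}

lemma IsLipschitzExtension.lipschitz_spaceTimeField (hv : IsLipschitzExtension T u v K B) :
    LipschitzWith K (spaceTimeField v) := by
  refine LipschitzWith.of_dist_le_mul fun a b => ?_
  rw [spaceTimeField, spaceTimeField, Prod.dist_eq]
  simpa using hv.lipschitz.dist_le_mul a b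

lemma IsLipschitzExtension.norm_spaceTimeField_le (hv : IsLipschitzExtension T u v K B)
    (z : ℝ × Space d) : ‖spaceTimeField v z‖ ≤ (1 + B : ℝ≥0) := by
  rw [spaceTimeField, Prod.norm_def]
  push_cast
  refine max_le (by simp) ((hv.norm_le z).trans (by simp))

lemma IsFlow.fst_eq (hθ : IsFlow (spaceTimeField v) θ) (t : ℝ) (z : ℝ × Space d) :
    (θ t z).1 = z.1 + t := by
  have hd : ∀ s, HasDerivAt (fun s => (θ s z).1 - s) 0 s := fun s => by
    have h1 : HasDerivAt (fun s => (θ s z).1) 1 s := by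
      simpa [spaceTimeField] using (hθ.hasDerivAt z s).hasFDerivAt.fst.hasDerivAt
    simpa using h1.fun_sub (hasDerivAt_id s)
  have h := is_const_of_deriv_eq_zero (fun s => (hd s).differentiableAt) (fun s => (hd s).deriv) t 0
  simp only [hθ.zero] at h
  linarith

lemma IsLipschitzExtension.flow_add_latticeVec (hv : IsLipschitzExtension T u v K B)
    (hθ : IsFlow (spaceTimeField v) θ) (t : ℝ) (z : ℝ × Space d) (k : Fin d → ℤ) :
    θ t (z + (0, latticeVec k)) = θ t z + (0, latticeVec k) :=
  hθ.map_add_of_periodic hv.lipschitz_spaceTimeField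
    (fun z => by simp only [spaceTimeField, hv.periodic]) t z

/-- The function that is constant along trajectories, with value `ψ` at time `s`. -/
def pullBack (θ : ℝ → ℝ × Space d → ℝ × Space d) (s : ℝ) (ψ : Space d → ℝ)
    (z : ℝ × Space d) : ℝ :=
  ψ (θ (s - z.1) z).2

lemma IsLipschitzExtension.pullBack_flow (hv : IsLipschitzExtension T u v K B)
    (hθ : IsFlow (spaceTimeField v) θ) (s : ℝ) (ψ : Space d → ℝ) (h : ℝ) (z : ℝ × Space d) :
    pullBack θ s ψ (θ h z) = pullBack θ s ψ z := by
  unfold pullBack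
  rw [hθ.fst_eq, ← hθ.map_add hv.lipschitz_spaceTimeField]
  congr 3
  ring

lemma IsLipschitzExtension.pullBack_add_latticeVec (hv : IsLipschitzExtension T u v K B)
    (hθ : IsFlow (spaceTimeField v) θ) (s : ℝ) {ψ : Space d → ℝ} (hψ : IsPeriodic ψ)
    (z : ℝ × Space d) (k : Fin d → ℤ) :
    pullBack θ s ψ (z + (0, latticeVec k)) = pullBack θ s ψ z := by
  unfold pullBack
  rw [hv.flow_add_latticeVec hθ, Prod.fst_add, Prod.snd_add, hψ.add_latticeVec, add_zero]

/-- The starting point is changed first, with the elapsed time fixed (Grönwall), then the elapsed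
time (speed at most `1 + B`). The margin `2` around `[0, T]` leaves room for a mollification radius
and a time step, each at most `1`. -/
lemma IsLipschitzExtension.abs_pullBack_sub_le (hv : IsLipschitzExtension T u v K B)
    (hθ : IsFlow (spaceTimeField v) θ) {s : ℝ} (hs : s ∈ Icc 0 T) {ψ : Space d → ℝ} {L : ℝ≥0}
    (hψ : LipschitzWith L ψ) {z z' : ℝ × Space d} (hz : z.1 ∈ Icc (-2) (T + 2)) :
    |pullBack θ s ψ z - pullBack θ s ψ z'| ≤
      L * (Real.exp (K * (T + 2)) + (1 + B)) * dist z z' := by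
  have h1 : dist (θ (s - z.1) z) (θ (s - z.1) z') ≤ dist z z' * Real.exp (K * (T + 2)) := by
    refine (hθ.dist_le hv.lipschitz_spaceTimeField _ _ _).trans ?_
    gcongr
    rw [abs_le]
    constructor <;> linarith [hs.1, hs.2, hz.1, hz.2]
  have h2 : dist (θ (s - z.1) z') (θ (s - z'.1) z') ≤ (1 + B) * dist z z' := by
    rw [dist_eq_norm]
    refine (hθ.norm_sub_le hv.norm_spaceTimeField_le _ _ _).trans ?_
    push_cast
    gcongr
    rw [sub_sub_sub_cancel_left, abs_sub_comm, ← Real.dist_eq]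
    exact le_max_left _ _
  rw [← Real.dist_eq]
  calc dist (pullBack θ s ψ z) (pullBack θ s ψ z')
      ≤ L * dist (θ (s - z.1) z).2 (θ (s - z'.1) z').2 := hψ.dist_le_mul _ _
    _ ≤ L * dist (θ (s - z.1) z) (θ (s - z'.1) z') := by
        gcongr
        exact le_max_right _ _
    _ ≤ L * (dist z z' * Real.exp (K * (T + 2)) + (1 + B) * dist z z') := by
        gcongr
        exact (dist_triangle _ _ _).trans (add_le_add h1 h2)
    _ = _ := by ring

lemma IsLipschitzExtension.continuous_pullBack (hv : IsLipschitzExtension T u v K B)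
    (hθ : IsFlow (spaceTimeField v) θ) (s : ℝ) {ψ : Space d → ℝ} (hψ : Continuous ψ) :
    Continuous (pullBack θ s ψ) := by
  have h := hθ.continuous_uncurry hv.lipschitz_spaceTimeField hv.norm_spaceTimeField_le
  exact hψ.comp (continuous_snd.comp
    (h.comp (f := fun z : ℝ × Space d => (s - z.1, z)) (by fun_prop)))

/-- The pull-back is constant along the flow, so the increment is controlled by the distance from `y
+ h • spaceTimeField v z` to `θ h y`. Freezing the field at `z` costs `h K ε`, and the Euler step
costs `O(h ^ 2)`. -/
lemma IsLipschitzExtension.abs_pullBack_increment_le (hv : IsLipschitzExtension T u v K B)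
    (hθ : IsFlow (spaceTimeField v) θ) {s : ℝ} (hs : s ∈ Icc 0 T) {ψ : Space d → ℝ} {L : ℝ≥0}
    (hψ : LipschitzWith L ψ) {z y : ℝ × Space d} (hz : z.1 ∈ Icc 0 T) {ε : ℝ} (hε : ε ≤ 1)
    (hy : y ∈ Metric.ball z ε) {h : ℝ} (hh : h ∈ Ioo (0 : ℝ) 1) :
    |pullBack θ s ψ (y + h • spaceTimeField v z) - pullBack θ s ψ y| ≤
      h * (L * (Real.exp (K * (T + 2)) + (1 + B)) * K * ε +
        L * (Real.exp (K * (T + 2)) + (1 + B)) * K * (1 + B) * h) := by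
  have hyz : |y.1 - z.1| < ε := by
    rw [← Real.dist_eq]
    exact (le_max_left _ _).trans_lt hy
  rw [abs_lt] at hyz
  have hmem : (y + h • spaceTimeField v z).1 ∈ Icc (-2) (T + 2) := by
    simp only [spaceTimeField, Prod.fst_add, Prod.smul_fst, smul_eq_mul, mul_one]
    constructor <;> linarith [hz.1, hz.2, hh.1, hh.2, hyz.1, hyz.2]
  rw [← hv.pullBack_flow hθ s ψ h y]
  refine (hv.abs_pullBack_sub_le hθ hs hψ hmem).trans ?_
  have h1 := hθ.norm_sub_sub_smul_le hv.lipschitz_spaceTimeField hv.norm_spaceTimeField_le h y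
  push_cast at h1
  have h2 : dist (spaceTimeField v z) (spaceTimeField v y) ≤ K * ε := by
    refine (hv.lipschitz_spaceTimeField.dist_le_mul _ _).trans ?_
    gcongr
    rw [dist_comm]
    exact (Metric.mem_ball.1 hy).le
  have h3 : dist (y + h • spaceTimeField v z) (θ h y) ≤ h * (K * ε) + K * (1 + B) * h ^ 2 := by
    refine (dist_triangle _ (y + h • spaceTimeField v y) _).trans (add_le_add ?_ ?_)
    · rw [dist_add_left, dist_smul₀, Real.norm_of_nonneg hh.1.le]
      exact mul_le_mul_of_nonneg_left h2 hh.1.le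
    · rw [dist_comm, dist_eq_norm]
      exact h1
  calc L * (Real.exp (K * (T + 2)) + (1 + B)) * dist (y + h • spaceTimeField v z) (θ h y)
      ≤ L * (Real.exp (K * (T + 2)) + (1 + B)) * (h * (K * ε) + K * (1 + B) * h ^ 2) := by
        gcongr
    _ = _ := by ring

lemma cell_subset_closedBall (d : ℕ) : cell d ⊆ Metric.closedBall 0 (d + 1) := fun _ hx =>
  mem_closedBall_zero_iff.2 (norm_le_of_mem_cell hx)

lemma integrableOn_cell_of_continuous {g : Space d → ℝ} (hg : Continuous g) :
    IntegrableOn g (cell d) :=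
  (hg.continuousOn.integrableOn_compact (isCompact_closedBall 0 ((d : ℝ) + 1))).mono_set
    (cell_subset_closedBall d)

lemma IsBinarySolution.abs_eq_one {J : Set ℝ} {ρ : ℝ → Space d → ℝ}
    (hρ : IsBinarySolution J u ρ) {t : ℝ} (ht : t ∈ J) (x : Space d) : |ρ t x| = 1 := by
  rcases hρ.binary t ht x with h | h <;> simp [h]

lemma IsBinarySolution.integrableOn_mul {J : Set ℝ} {ρ : ℝ → Space d → ℝ}
    (hρ : IsBinarySolution J u ρ) {t : ℝ} (ht : t ∈ J) {g : Space d → ℝ} (hg : Continuous g) :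
    IntegrableOn (fun x => ρ t x * g x) (cell d) :=
  (integrableOn_cell_of_continuous hg).bdd_mul (c := 1) (hρ.measurable_slice t ht).restrict
    (Filter.Eventually.of_forall fun x => by rw [Real.norm_eq_abs, hρ.abs_eq_one ht])

lemma deriv_add_fderiv_slices {f : ℝ × Space d → ℝ} (hf : Differentiable ℝ f) (t : ℝ)
    (x y : Space d) :
    deriv (fun r => f (r, x)) t + fderiv ℝ (fun x => f (t, x)) x y =
      fderiv ℝ f (t, x) (1, y) := by
  have h1 : HasDerivAt (fun r => f (r, x)) (fderiv ℝ f (t, x) (1, 0)) t :=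
    (hf (t, x)).hasFDerivAt.comp_hasDerivAt t ((hasDerivAt_id t).prodMk (hasDerivAt_const t x))
  have h2 : HasFDerivAt (fun x => f (t, x))
      ((fderiv ℝ f (t, x)).comp (ContinuousLinearMap.inr ℝ ℝ (Space d))) x :=
    (hf (t, x)).hasFDerivAt.comp x (hasFDerivAt_prodMk_right t x)
  rw [h1.deriv, h2.fderiv, ContinuousLinearMap.comp_apply, ← _root_.map_add]
  simp

/-- A weak solution is transported by the flow, tested against Lipschitz functions. -/
lemma IsBinarySolution.integral_comp_flow (hv : IsLipschitzExtension T u v K B)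
    (hθ : IsFlow (spaceTimeField v) θ) {ρ : ℝ → Space d → ℝ}
    (hρ : IsBinarySolution (Icc 0 T) u ρ) {s t : ℝ} (hs : s ∈ Icc 0 T) (ht : t ∈ Icc 0 T)
    {ψ : Space d → ℝ} {L : ℝ≥0} (hψ : LipschitzWith L ψ) (hψp : IsPeriodic ψ) :
    ∫ x in cell d, ρ t x * ψ (θ (s - t) (t, x)).2 = ∫ x in cell d, ρ s x * ψ x := by
  set L' : ℝ := L * (Real.exp (K * (T + 2)) + (1 + B)) with hL'
  have hL'0 : 0 ≤ L' := by positivity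
  have hT0 : 0 ≤ T := hs.1.trans hs.2
  set Φ := pullBack θ s ψ with hΦ
  have hΦc : Continuous Φ := hv.continuous_pullBack hθ s hψ.continuous
  have hvol : volume.real (cell d) = 1 := by rw [measureReal_def, volume_cell]; simp
  -- The weak formulation is applied to the mollification `Ψ` of `Φ` at scale `ε`. The transport
  -- derivative of `Ψ` is at most `L' K ε`, which yields `L' K T ε` after time integration;
  -- replacing `Ψ` by `Φ` costs `L' ε` at each of the two times.
  have key : ∀ ε : ℝ, 0 < ε → ε ≤ 1 → ∀ r ∈ Icc 0 T,
      |(∫ x in cell d, ρ r x * Φ (r, x)) - ∫ x in cell d, ρ 0 x * Φ (0, x)| ≤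
        (L' * K * T + 2 * L') * ε := by
    intro ε hε hε1 r hr
    let φ : ContDiffBump (0 : ℝ × Space d) := ⟨ε / 2, ε, by positivity, by linarith⟩
    set Ψ := mollify ((volume : Measure ℝ).prod (volume : Measure (Space d))) φ Φ with hΨ
    have hΨs : ContDiff ℝ ∞ Ψ := contDiff_mollify hΦc
    have hclose : ∀ r ∈ Icc 0 T, ∀ x, |Ψ (r, x) - Φ (r, x)| ≤ L' * ε := by
      intro r hr x
      refine abs_mollify_sub_le hΦc fun y hy => ?_
      rw [abs_sub_comm]
      refine (hv.abs_pullBack_sub_le hθ hs hψ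
        ⟨by linarith [hr.1], by linarith [hr.2]⟩).trans ?_
      rw [dist_comm]
      exact mul_le_mul_of_nonneg_left (Metric.mem_ball.1 hy).le hL'0
    have hint : ∀ r ∈ Icc 0 T,
        |(∫ x in cell d, ρ r x * Ψ (r, x)) - ∫ x in cell d, ρ r x * Φ (r, x)| ≤ L' * ε := by
      intro r hr
      rw [← integral_sub (hρ.integrableOn_mul hr
          (g := fun x => Ψ (r, x)) (hΨs.continuous.comp (by fun_prop)))
        (hρ.integrableOn_mul hr (g := fun x => Φ (r, x)) (hΦc.comp (by fun_prop)))]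
      have h := norm_setIntegral_le_of_norm_le_const (μ := volume) (s := cell d)
        (f := fun x => ρ r x * Ψ (r, x) - ρ r x * Φ (r, x)) (C := L' * ε)
        (by rw [volume_cell]; simp) fun x _ => by
          rw [← mul_sub, norm_mul, Real.norm_eq_abs, Real.norm_eq_abs, hρ.abs_eq_one hr, one_mul]
          exact hclose r hr x
      rwa [hvol, mul_one, Real.norm_eq_abs] at h
    have hweak := hρ.weak (fun r x => Ψ (r, x)) hΨs (fun r => isPeriodic_of_add_latticeVec
      fun x k => by
        have := mollify_add_of_periodic
          (μ := (volume : Measure ℝ).prod (volume : Measure (Space d))) (φ := φ)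
          (fun z => hv.pullBack_add_latticeVec hθ s hψp z k) (r, x)
        simpa using this) r hr
    have hrhs : |∫ s in (0 : ℝ)..r, ∫ x in cell d,
        ρ s x * (deriv (fun r => Ψ (r, x)) s + fderiv ℝ (fun x => Ψ (s, x)) x (u s x))| ≤
        L' * K * ε * |r - 0| := by
      rw [← Real.norm_eq_abs]
      refine intervalIntegral.norm_integral_le_of_norm_le_const fun σ hσ => ?_
      rw [uIoc_of_le hr.1] at hσ
      have hσT : σ ∈ Icc 0 T := ⟨hσ.1.le, hσ.2.trans hr.2⟩
      have h := norm_setIntegral_le_of_norm_le_const (μ := volume) (s := cell d)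
        (f := fun x => ρ σ x * (deriv (fun r => Ψ (r, x)) σ +
          fderiv ℝ (fun x => Ψ (σ, x)) x (u σ x))) (C := L' * K * ε)
        (by rw [volume_cell]; simp) fun x _ => by
          rw [norm_mul, Real.norm_eq_abs, Real.norm_eq_abs, hρ.abs_eq_one hσT, one_mul,
            deriv_add_fderiv_slices (hΨs.differentiable (by simp)), ← hv.eq σ hσT]
          exact abs_fderiv_mollify_le (z := (σ, x)) hΦc one_pos fun y hy h hh =>
            hv.abs_pullBack_increment_le hθ hs hψ hσT hε1 hy hh
      rwa [hvol, mul_one] at h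
    rw [sub_zero, abs_of_nonneg hr.1] at hrhs
    rw [← hweak] at hrhs
    have h1 := hint r hr
    have h2 := hint 0 ⟨le_rfl, hT0⟩
    have h3 : L' * K * ε * r ≤ L' * K * T * ε := by
      have : L' * K * ε * r ≤ L' * K * ε * T := by gcongr; exact hr.2
      linarith
    rw [abs_le] at *
    constructor <;> linarith
  have hconst : ∀ r ∈ Icc 0 T,
      ∫ x in cell d, ρ r x * Φ (r, x) = ∫ x in cell d, ρ 0 x * Φ (0, x) := by
    intro r hr
    have hC : 0 ≤ L' * K * T + 2 * L' := by positivity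
    rw [← sub_eq_zero, ← abs_nonpos_iff]
    refine le_of_forall_pos_le_add fun η hη => ?_
    rw [zero_add]
    set C := L' * K * T + 2 * L'
    -- `C` may vanish, so the division is by `C + 1`.
    refine (key (min 1 (η / (C + 1))) (by positivity) (min_le_left _ _) r hr).trans ?_
    calc C * min 1 (η / (C + 1)) ≤ (C + 1) * (η / (C + 1)) := by
          gcongr
          · linarith
          · exact min_le_right _ _
      _ = η := by field_simp
  have h := (hconst t ht).trans (hconst s hs).symm
  simpa [hΦ, pullBack, hθ.zero] using h

end Transport

/-! ### Measures on the torus and Jordan decompositions -/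

/-- The quotient map to the torus. -/
def toTorus {d : ℕ} (x : Space d) : Fin d → AddCircle (1 : ℝ) := fun i => (x i : AddCircle (1 : ℝ))

/-- The section of the quotient map with values in the period cell. -/
def fromTorus {d : ℕ} (a : Fin d → AddCircle (1 : ℝ)) : Space d :=
  WithLp.toLp 2 fun i => (AddCircle.measurableEquivIco 1 0 (a i) : ℝ)

lemma measurable_fromTorus {d : ℕ} :
    Measurable (fromTorus : (Fin d → AddCircle (1 : ℝ)) → Space d) := by
  refine (WithLp.measurable_toLp 2 _).comp (measurable_pi_lambda _ fun i => ?_)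
  exact measurable_subtype_coe.comp
    ((AddCircle.measurableEquivIco 1 0).measurable.comp (measurable_pi_apply i))

lemma fromTorus_toTorus {d : ℕ} (x : Space d) : fromTorus (toTorus x) = wrap x := by
  ext i
  have h := AddCircle.coe_equivIco_mk_apply (p := (1 : ℝ)) (x i)
  rw [div_one, mul_one] at h
  exact h

lemma lipschitzWith_toTorus {d : ℕ} :
    LipschitzWith 1 (toTorus : Space d → Fin d → AddCircle (1 : ℝ)) := by
  refine LipschitzWith.of_dist_le_mul fun x y => ?_
  rw [NNReal.coe_one, one_mul]
  refine (dist_pi_le_iff dist_nonneg).2 fun i => ?_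
  have h1 : dist (toTorus x i) (toTorus y i) = ‖((x i - y i : ℝ) : AddCircle (1 : ℝ))‖ := by
    rw [dist_eq_norm]; rfl
  rw [h1, dist_eq_norm]
  refine QuotientAddGroup.norm_mk_le_norm.trans ?_
  exact PiLp.norm_apply_le (x - y) i

lemma toTorus_add_latticeVec {d : ℕ} (x : Space d) (k : Fin d → ℤ) :
    toTorus (x + latticeVec k) = toTorus x := by
  funext i
  simp [toTorus]

/-- Finite measures that agree on periodic Lipschitz functions agree on the torus. -/
lemma map_wrap_eq_of_forall_integral_eq {d : ℕ} {μ ν : Measure (Space d)} [IsFiniteMeasure μ]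
    [IsFiniteMeasure ν]
    (h : ∀ (ψ : Space d → ℝ) (L : ℝ≥0), LipschitzWith L ψ → IsPeriodic ψ →
      (∀ x, ψ x ∈ Icc (0 : ℝ) 1) → ∫ x, ψ x ∂μ = ∫ x, ψ x ∂ν) :
    μ.map wrap = ν.map wrap := by
  have hm : Measurable (toTorus : Space d → _) := lipschitzWith_toTorus.continuous.measurable
  -- Thickened indicators on the torus pull back to periodic Lipschitz functions with values in `[0,
  -- 1]`. They converge to the indicators of closed sets, which form a generating π-system. The
  -- detour through the torus is needed because `wrap` is discontinuous; it is `toTorus` followed by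
  -- a measurable section.
  have hlint : ∀ (δ : ℝ) (hδ : 0 < δ) (F : Set (Fin d → AddCircle (1 : ℝ))),
      ∫⁻ a, thickenedIndicator hδ F a ∂(μ.map toTorus) =
        ∫⁻ a, thickenedIndicator hδ F a ∂(ν.map toTorus) := by
    intro δ hδ F
    have hc : Measurable fun a => (thickenedIndicator hδ F a : ℝ≥0∞) :=
      (thickenedIndicator hδ F).continuous.measurable.coe_nnreal_ennreal
    rw [lintegral_map hc hm, lintegral_map hc hm]
    have hlip : LipschitzWith δ.toNNReal⁻¹
        fun x : Space d => (thickenedIndicator hδ F (toTorus x) : ℝ) := by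
      have h1 := (lipschitzWith_thickenedIndicator hδ F).comp (lipschitzWith_toTorus (d := d))
      rw [mul_one] at h1
      exact h1
    have h1 := h _ _ hlip
      (isPeriodic_of_add_latticeVec fun x k => by simp only [toTorus_add_latticeVec])
      (fun x => ⟨NNReal.coe_nonneg _, by
        exact_mod_cast thickenedIndicator_le_one hδ F (toTorus x)⟩)
    have hb : ∀ (m : Measure (Space d)) [IsFiniteMeasure m],
        ∫⁻ x, thickenedIndicator hδ F (toTorus x) ∂m =
          ENNReal.ofReal (∫ x, (thickenedIndicator hδ F (toTorus x) : ℝ) ∂m) := by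
      intro m _
      rw [ofReal_integral_eq_lintegral_ofReal]
      · simp
      · refine Integrable.of_bound (C := 1) hlip.continuous.aestronglyMeasurable
          (Filter.Eventually.of_forall fun x => ?_)
        rw [Real.norm_of_nonneg (NNReal.coe_nonneg _)]
        exact_mod_cast thickenedIndicator_le_one hδ F (toTorus x)
      · exact Filter.Eventually.of_forall fun x => NNReal.coe_nonneg _
    rw [hb μ, hb ν, h1]
  have htorus : μ.map toTorus = ν.map toTorus := by
    have hclosed : ∀ F : Set (Fin d → AddCircle (1 : ℝ)), IsClosed F →
        μ.map toTorus F = ν.map toTorus F := by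
      intro F hF
      have h1 := tendsto_lintegral_thickenedIndicator_of_isClosed (μ.map toTorus) hF
        (fun n : ℕ => Nat.one_div_pos_of_nat (α := ℝ) (n := n))
        tendsto_one_div_add_atTop_nhds_zero_nat
      have h2 := tendsto_lintegral_thickenedIndicator_of_isClosed (ν.map toTorus) hF
        (fun n : ℕ => Nat.one_div_pos_of_nat (α := ℝ) (n := n))
        tendsto_one_div_add_atTop_nhds_zero_nat
      simp_rw [hlint] at h1
      exact tendsto_nhds_unique h1 h2
    refine ext_of_generate_finite _ ?_ isPiSystem_isClosed (fun F hF => hclosed F hF)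
      (hclosed _ isClosed_univ)
    rw [BorelSpace.measurable_eq (α := Fin d → AddCircle (1 : ℝ)), borel_eq_generateFrom_isClosed]
  have e : (wrap : Space d → Space d) = fromTorus ∘ toTorus := by
    funext x
    exact (fromTorus_toTorus x).symm
  rw [e, ← Measure.map_map measurable_fromTorus hm, ← Measure.map_map measurable_fromTorus hm,
    htorus]

/-- `P'` lives on a set where `N'` vanishes, and there the identity reads `P = N + P'`. -/
lemma le_of_add_eq_add_of_mutuallySingular {α : Type*} [MeasurableSpace α]
    {P N P' N' : Measure α} (hs : P'.MutuallySingular N') (h : P + N' = N + P') : P' ≤ P := by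
  obtain ⟨S, -, hP, hN⟩ := hs
  refine Measure.le_iff'.2 fun E => ?_
  have h0 : N' (E ∩ Sᶜ) = 0 := measure_mono_null inter_subset_right hN
  calc P' E ≤ P' (E ∩ S) + P' (E ∩ Sᶜ) := by
        rw [← inter_union_compl E S]
        exact (measure_mono (by simp)).trans (measure_union_le _ _)
    _ = P' (E ∩ Sᶜ) := by rw [measure_mono_null inter_subset_right hP, zero_add]
    _ ≤ N (E ∩ Sᶜ) + P' (E ∩ Sᶜ) := le_add_self
    _ = P (E ∩ Sᶜ) + N' (E ∩ Sᶜ) := by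
        rw [← Measure.add_apply, ← Measure.add_apply, h]
    _ = P (E ∩ Sᶜ) := by rw [h0, add_zero]
    _ ≤ P E := measure_mono inter_subset_left

/-- A Jordan decomposition is the unique decomposition of its total mass. -/
lemma eq_and_eq_of_add_eq_add_of_mutuallySingular {α : Type*} [MeasurableSpace α]
    {P N P' N' : Measure α} [IsFiniteMeasure P] [IsFiniteMeasure N] [IsFiniteMeasure P']
    [IsFiniteMeasure N'] (hs : P'.MutuallySingular N') (h : P + N' = N + P')
    (hmass : P univ + N univ = P' univ + N' univ) : P = P' ∧ N = N' := by
  have h1 : P' ≤ P := le_of_add_eq_add_of_mutuallySingular hs h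
  have h2 : N' ≤ N := le_of_add_eq_add_of_mutuallySingular hs.symm h.symm
  have e1 : P' univ = P univ := by
    refine le_antisymm (h1 univ) ?_
    have : P univ + N univ ≤ P' univ + N univ := by
      rw [hmass]
      gcongr
    exact ENNReal.le_of_add_le_add_right (measure_ne_top _ _) this
  have e2 : N' univ = N univ := by
    rw [e1] at hmass
    exact ((ENNReal.add_right_inj (measure_ne_top _ _)).1 hmass).symm
  exact ⟨(Measure.eq_of_le_of_measure_univ_eq h1 e1).symm,
    (Measure.eq_of_le_of_measure_univ_eq h2 e2).symm⟩

/-- The measure `ρ₊ dx` on the period cell. -/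
abbrev plusMeasure {d : ℕ} (ρ : Space d → ℝ) : Measure (Space d) :=
  densityMeasure fun x => 2 * max (ρ x) 0

/-- The measure `ρ₋ dx` on the period cell. -/
abbrev minusMeasure {d : ℕ} (ρ : Space d → ℝ) : Measure (Space d) :=
  densityMeasure fun x => -2 * min (ρ x) 0

lemma densityMeasure_le {d : ℕ} {f : Space d → ℝ} {M : ℝ≥0∞} (hM : ∀ x, ENNReal.ofReal (f x) ≤ M) :
    densityMeasure f ≤ M • volume.restrict (cell d) := by
  rw [← withDensity_const]
  exact withDensity_mono (Filter.Eventually.of_forall hM)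

lemma map_wrap_densityMeasure {d : ℕ} (f : Space d → ℝ) :
    (densityMeasure f).map wrap = densityMeasure f := by
  have h : ∀ᵐ x ∂(densityMeasure f), wrap x = x := by
    refine (withDensity_absolutelyContinuous _ _).ae_le ?_
    exact (ae_restrict_mem (measurableSet_cell d)).mono fun x hx => wrap_of_mem_cell hx
  rw [Measure.map_congr (g := id) h, Measure.map_id]

lemma integral_densityMeasure {d : ℕ} {f : Space d → ℝ} (hf : AEMeasurable f volume)
    (h0 : ∀ x, 0 ≤ f x) (g : Space d → ℝ) :
    ∫ x, g x ∂(densityMeasure f) = ∫ x in cell d, f x * g x := by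
  rw [densityMeasure, integral_withDensity_eq_integral_toReal_smul₀
    hf.restrict.ennreal_ofReal (Filter.Eventually.of_forall fun x => ENNReal.ofReal_lt_top)]
  simp only [ENNReal.toReal_ofReal (h0 _), smul_eq_mul]

section Binary

variable {d : ℕ} {ρ : Space d → ℝ}

lemma plusMeasure_le (hb : ∀ x, ρ x = 1 ∨ ρ x = -1) :
    plusMeasure ρ ≤ (2 : ℝ≥0∞) • volume.restrict (cell d) :=
  densityMeasure_le fun x => by rcases hb x with h | h <;> simp [h]

lemma minusMeasure_le (hb : ∀ x, ρ x = 1 ∨ ρ x = -1) :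
    minusMeasure ρ ≤ (2 : ℝ≥0∞) • volume.restrict (cell d) :=
  densityMeasure_le fun x => by rcases hb x with h | h <;> simp [h]

lemma isFiniteMeasure_of_le_smul {μ : Measure (Space d)}
    (h : μ ≤ (2 : ℝ≥0∞) • volume.restrict (cell d)) : IsFiniteMeasure μ := by
  refine ⟨(h univ).trans_lt ?_⟩
  simp

lemma plusMeasure_add_minusMeasure (hb : ∀ x, ρ x = 1 ∨ ρ x = -1)
    (hm : AEStronglyMeasurable ρ volume) :
    plusMeasure ρ + minusMeasure ρ = (2 : ℝ≥0∞) • volume.restrict (cell d) := by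
  have hmeas : AEMeasurable (fun x => 2 * max (ρ x) 0) (volume.restrict (cell d)) :=
    ((hm.aemeasurable.restrict).max aemeasurable_const).const_mul 2
  rw [← withDensity_const]
  ext S hS
  rw [Measure.add_apply, plusMeasure, minusMeasure, densityMeasure, densityMeasure,
    withDensity_apply _ hS, withDensity_apply _ hS, withDensity_apply _ hS,
    ← lintegral_add_left' hmeas.ennreal_ofReal.restrict]
  refine lintegral_congr fun x => ?_
  rcases hb x with h | h <;> simp [h]

lemma mutuallySingular_plusMeasure_minusMeasure (hb : ∀ x, ρ x = 1 ∨ ρ x = -1)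
    (hm : AEStronglyMeasurable ρ volume) :
    (plusMeasure ρ).MutuallySingular (minusMeasure ρ) := by
  -- `ρ` is only almost everywhere strongly measurable, so the separating set is defined by a
  -- measurable representative.
  have hms : MeasurableSet {x | hm.mk ρ x = -1} :=
    hm.stronglyMeasurable_mk.measurable (measurableSet_singleton _)
  have hae : ∀ᵐ x ∂volume.restrict (cell d), ρ x = hm.mk ρ x := ae_restrict_of_ae hm.ae_eq_mk
  refine ⟨{x | hm.mk ρ x = -1}, hms, ?_, ?_⟩
  · rw [plusMeasure, densityMeasure, withDensity_apply _ hms, lintegral_eq_zero_of_ae_eq_zero]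
    filter_upwards [ae_restrict_mem hms, ae_restrict_of_ae hae] with x hx hρ
    rw [← hρ] at hx
    simp [hx]
  · rw [minusMeasure, densityMeasure, withDensity_apply _ hms.compl,
      lintegral_eq_zero_of_ae_eq_zero]
    filter_upwards [ae_restrict_mem hms.compl, ae_restrict_of_ae hae] with x hx hρ
    have hx' : ρ x ≠ -1 := fun h => hx (hρ.symm.trans h)
    simp [(hb x).resolve_right hx']

lemma integral_plusMeasure_sub_integral_minusMeasure (hb : ∀ x, ρ x = 1 ∨ ρ x = -1)
    (hm : AEStronglyMeasurable ρ volume) {g : Space d → ℝ} (hg : Continuous g) :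
    ∫ x, g x ∂(plusMeasure ρ) - ∫ x, g x ∂(minusMeasure ρ) = 2 * ∫ x in cell d, ρ x * g x := by
  have hmp : AEMeasurable (fun x => 2 * max (ρ x) 0) volume :=
    (hm.aemeasurable.max aemeasurable_const).const_mul 2
  have hmn : AEMeasurable (fun x => -2 * min (ρ x) 0) volume :=
    (hm.aemeasurable.min aemeasurable_const).const_mul (-2)
  rw [integral_densityMeasure hmp (fun x => by positivity),
    integral_densityMeasure hmn (fun x => by nlinarith [min_le_right (ρ x) 0]),
    ← integral_sub, ← integral_const_mul]
  · refine integral_congr_ae (Filter.Eventually.of_forall fun x => ?_)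
    rcases hb x with h | h <;> simp [h]
  · refine (integrableOn_cell_of_continuous hg).bdd_mul (c := 2)
      hmp.aestronglyMeasurable.restrict (Filter.Eventually.of_forall fun x => ?_)
    rcases hb x with h | h <;> simp [h]
  · refine (integrableOn_cell_of_continuous hg).bdd_mul (c := 2)
      hmn.aestronglyMeasurable.restrict (Filter.Eventually.of_forall fun x => ?_)
    rcases hb x with h | h <;> simp [h]

end Binary

/-- The flow from time `t` to time `s`, with values in the period cell, transports `ρ₊` and
`ρ₋`. -/
lemma IsBinarySolution.map_flow {d : ℕ} {T : ℝ} {u : ℝ → Space d → Space d}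
    {v : ℝ × Space d → Space d} {K B : ℝ≥0} {θ : ℝ → ℝ × Space d → ℝ × Space d}
    (hv : IsLipschitzExtension T u v K B)
    (hθ : IsFlow (spaceTimeField v) θ) {ρ : ℝ → Space d → ℝ}
    (hρ : IsBinarySolution (Icc 0 T) u ρ) {s t : ℝ} (hs : s ∈ Icc 0 T) (ht : t ∈ Icc 0 T) :
    (plusMeasure (ρ t)).map (fun x => wrap (θ (s - t) (t, x)).2) = plusMeasure (ρ s) ∧
    (minusMeasure (ρ t)).map (fun x => wrap (θ (s - t) (t, x)).2) = minusMeasure (ρ s) := by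
  have hc : Continuous fun x => (θ (s - t) (t, x)).2 := by
    have h := hθ.continuous_uncurry hv.lipschitz_spaceTimeField hv.norm_spaceTimeField_le
    exact continuous_snd.comp (h.comp (f := fun x : Space d => (s - t, t, x)) (by fun_prop))
  set X : Space d → Space d := fun x => (θ (s - t) (t, x)).2 with hX
  have ht1 := isFiniteMeasure_of_le_smul (plusMeasure_le (hρ.binary t ht))
  have ht2 := isFiniteMeasure_of_le_smul (minusMeasure_le (hρ.binary t ht))
  have hs1 := isFiniteMeasure_of_le_smul (plusMeasure_le (hρ.binary s hs))
  have hs2 := isFiniteMeasure_of_le_smul (minusMeasure_le (hρ.binary s hs))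
  have hm : Measurable fun x => wrap (X x) := measurable_wrap.comp hc.measurable
  -- The transport of the signed measure `ρ dx`, written as an identity of sums of positive
  -- measures.
  have hsum : (plusMeasure (ρ t)).map (fun x => wrap (X x)) + minusMeasure (ρ s) =
      (minusMeasure (ρ t)).map (fun x => wrap (X x)) + plusMeasure (ρ s) := by
    have h := map_wrap_eq_of_forall_integral_eq
      (μ := (plusMeasure (ρ t)).map X + minusMeasure (ρ s))
      (ν := (minusMeasure (ρ t)).map X + plusMeasure (ρ s)) ?_
    · rw [Measure.map_add _ _ measurable_wrap, Measure.map_add _ _ measurable_wrap,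
        Measure.map_map measurable_wrap hc.measurable,
        Measure.map_map measurable_wrap hc.measurable, map_wrap_densityMeasure,
        map_wrap_densityMeasure] at h
      exact h
    · intro ψ L hψ hψp hψ1
      have hi : ∀ (m : Measure (Space d)) [IsFiniteMeasure m], Integrable ψ m := fun m _ =>
        Integrable.of_bound (C := 1) hψ.continuous.aestronglyMeasurable
          (Filter.Eventually.of_forall fun x => by
            rw [Real.norm_of_nonneg (hψ1 x).1]
            exact (hψ1 x).2)
      rw [integral_add_measure (hi _) (hi _), integral_add_measure (hi _) (hi _),
        integral_map hc.aemeasurable hψ.continuous.aestronglyMeasurable,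
        integral_map hc.aemeasurable hψ.continuous.aestronglyMeasurable]
      have h1 := integral_plusMeasure_sub_integral_minusMeasure (hρ.binary t ht)
        (hρ.measurable_slice t ht) (hψ.continuous.comp hc)
      have h2 := integral_plusMeasure_sub_integral_minusMeasure (hρ.binary s hs)
        (hρ.measurable_slice s hs) hψ.continuous
      have h3 := hρ.integral_comp_flow hv hθ hs ht hψ hψp
      simp only [Function.comp_apply] at h1
      rw [h3] at h1
      linarith
  -- At either time the two measures add up to `2 dx` on the cell, and a push-forward preserves
  -- mass.
  refine eq_and_eq_of_add_eq_add_of_mutuallySingular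
    (mutuallySingular_plusMeasure_minusMeasure (hρ.binary s hs) (hρ.measurable_slice s hs)) hsum ?_
  rw [Measure.map_apply hm MeasurableSet.univ, Measure.map_apply hm MeasurableSet.univ,
    preimage_univ, ← Measure.add_apply, ← Measure.add_apply,
    plusMeasure_add_minusMeasure (hρ.binary t ht) (hρ.measurable_slice t ht),
    plusMeasure_add_minusMeasure (hρ.binary s hs) (hρ.measurable_slice s hs)]

/-! ### Extension of the velocity field to all times -/

/-- The field and its spatial gradient are frozen at the end points of the time interval.
Periodicity reduces their bounds to a compact set, and convexity of the slab turns the gradient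
bound into a Lipschitz bound. The extended gradient `G` stays jointly continuous, which makes the
maximal function along trajectories continuous. -/
lemma IsStirringField.exists_extension {d : ℕ} {T : ℝ} (hT : 0 < T) {u : ℝ → Space d → Space d}
    (hu : IsStirringField (Icc 0 T) u) :
    ∃ (v : ℝ × Space d → Space d) (K B : ℝ≥0) (G : ℝ → Space d → Space d →L[ℝ] Space d),
      IsLipschitzExtension T u v K B ∧ (Continuous fun z : ℝ × Space d => G z.1 z.2) ∧
      (∀ t ∈ Icc 0 T, ∀ x, HasFDerivAt (u t) (G t x) x) ∧ (∀ t, IsPeriodic (G t)) ∧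
      ∀ t x, ‖G t x‖ ≤ K := by
  set F : ℝ × Space d → Space d := fun z => u z.1 z.2 with hF
  set S : Set (ℝ × Space d) := Icc 0 T ×ˢ univ with hS
  have hSu : UniqueDiffOn ℝ S := (uniqueDiffOn_Icc hT).prod uniqueDiffOn_univ
  set F' := fderivWithin ℝ F S with hF'
  have hF'c : ContinuousOn F' S := hu.smooth.continuousOn_fderivWithin hSu (by simp)
  have hFd : ∀ z ∈ S, HasFDerivWithinAt F (F' z) S z := fun z hz =>
    ((hu.smooth.differentiableOn (by simp)) z hz).hasFDerivWithinAt
  have hFper : ∀ z ∈ S, ∀ k, F (z + (0, latticeVec k)) = F z := fun z hz k => by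
    simp only [hF, Prod.fst_add, Prod.snd_add, add_zero]
    exact (hu.periodic z.1 hz.1).add_latticeVec z.2 k
  have hSadd : ∀ z ∈ S, ∀ k : Fin d → ℤ, z + (0, latticeVec k) ∈ S := fun z hz k => by
    simpa [hS] using hz
  -- Derivatives within the closed slab are unique, so they inherit the periodicity of `F`.
  have hF'per : ∀ z ∈ S, ∀ k, F' (z + (0, latticeVec k)) = F' z := by
    intro z hz k
    have h1 : HasFDerivWithinAt (fun z => F (z + (0, latticeVec k)))
        (F' (z + (0, latticeVec k))) S z := by
      have := (hFd _ (hSadd z hz k)).comp z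
        ((hasFDerivWithinAt_id z S).add_const ((0, latticeVec k) : ℝ × Space d))
        (fun y hy => hSadd y hy k)
      simpa [Function.comp_def] using this
    have h2 : HasFDerivWithinAt F (F' (z + (0, latticeVec k))) S z :=
      h1.congr (fun y hy => (hFper y hy k).symm) (hFper z hz k).symm
    exact (hSu z hz).eq h2 (hFd z hz)
  have hQ : IsCompact (Icc (0 : ℝ) T ×ˢ Metric.closedBall (0 : Space d) (d + 1)) :=
    isCompact_Icc.prod (isCompact_closedBall _ _)
  have hQS : Icc (0 : ℝ) T ×ˢ Metric.closedBall (0 : Space d) (d + 1) ⊆ S :=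
    prod_mono le_rfl (subset_univ _)
  have hred : ∀ z ∈ S, ∃ k : Fin d → ℤ, z + (0, latticeVec k) ∈
      Icc (0 : ℝ) T ×ˢ Metric.closedBall (0 : Space d) (d + 1) := by
    intro z hz
    obtain ⟨k, hk⟩ := exists_norm_add_latticeVec_le z.2
    exact ⟨k, by simpa using hz.1, by simpa using hk⟩
  obtain ⟨C₁, hC₁⟩ := hQ.exists_bound_of_continuousOn (hF'c.mono hQS)
  obtain ⟨C₂, hC₂⟩ := hQ.exists_bound_of_continuousOn (hu.smooth.continuousOn.mono hQS)
  have hF'b : ∀ z ∈ S, ‖F' z‖ ≤ C₁.toNNReal := by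
    intro z hz
    obtain ⟨k, hk⟩ := hred z hz
    rw [← hF'per z hz k]
    exact (hC₁ _ hk).trans (Real.le_coe_toNNReal _)
  have hFb : ∀ z ∈ S, ‖F z‖ ≤ C₂.toNNReal := by
    intro z hz
    obtain ⟨k, hk⟩ := hred z hz
    rw [← hFper z hz k]
    exact (hC₂ _ hk).trans (Real.le_coe_toNNReal _)
  have hFlip : LipschitzOnWith C₁.toNNReal F S :=
    ((convex_Icc 0 T).prod convex_univ).lipschitzOnWith_of_nnnorm_hasFDerivWithin_le hFd
      fun z hz => hF'b z hz
  let c : ℝ × Space d → ℝ × Space d := fun z => ((projIcc 0 T hT.le z.1 : ℝ), z.2)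
  have hcS : ∀ z, c z ∈ S := fun z => ⟨(projIcc 0 T hT.le z.1).2, trivial⟩
  have hcadd : ∀ z k, c (z + (0, latticeVec k)) = c z + (0, latticeVec k) := fun z k => by
    simp [c]
  have hclip : LipschitzWith 1 c := by
    refine LipschitzWith.of_dist_le_mul fun a b => ?_
    rw [NNReal.coe_one, one_mul, Prod.dist_eq, Prod.dist_eq]
    refine max_le_max ?_ le_rfl
    have := (LipschitzWith.projIcc hT.le).dist_le_mul a.1 b.1
    simpa [Subtype.dist_eq] using this
  have hceq : ∀ t ∈ Icc 0 T, ∀ x, c (t, x) = (t, x) := fun t ht x => by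
    simp [c, projIcc_of_mem hT.le ht]
  refine ⟨fun z => F (c z), C₁.toNNReal, C₂.toNNReal,
    fun t x => (F' (c (t, x))).comp (ContinuousLinearMap.inr ℝ ℝ (Space d)), ?_, ?_, ?_, ?_, ?_⟩
  · refine ⟨?_, fun z => hFb _ (hcS z), fun z k => ?_, fun t ht x => ?_⟩
    · refine LipschitzWith.of_dist_le_mul fun a b => ?_
      refine (hFlip.dist_le_mul _ (hcS a) _ (hcS b)).trans ?_
      gcongr
      simpa using hclip.dist_le_mul a b
    · simp only [hcadd]
      exact hFper _ (hcS z) k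
    · simp only [hceq t ht x, hF]
  · have : Continuous fun z : ℝ × Space d => F' (c z) :=
      hF'c.comp_continuous hclip.continuous hcS
    exact this.clm_comp continuous_const
  · intro t ht x
    simp only [hceq t ht x]
    have hp : HasFDerivWithinAt (fun y : Space d => (t, y)) (ContinuousLinearMap.inr ℝ ℝ (Space d))
      univ x := (hasFDerivAt_prodMk_right t x).hasFDerivWithinAt
    have h := (hFd (t, x) ⟨ht, trivial⟩).comp x hp (fun y _ => ⟨ht, trivial⟩)
    rw [hasFDerivWithinAt_univ] at h
    exact h
  · intro t
    refine isPeriodic_of_add_latticeVec fun x k => ?_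
    have h := hcadd (t, x) k
    simp only [Prod.mk_add_mk, add_zero] at h
    simp only [h, hF'per _ (hcS (t, x)) k]
  · intro t x
    refine (ContinuousLinearMap.opNorm_comp_le _ _).trans ?_
    refine (mul_le_mul (hF'b _ (hcS (t, x))) (ContinuousLinearMap.norm_inr_le_one ℝ ℝ (Space d))
      (norm_nonneg _) (NNReal.coe_nonneg _)).trans ?_
    rw [mul_one]

/-! ### Separation of trajectories -/

/-- Grönwall's inequality backwards in time, with a variable rate. -/
lemma norm_le_norm_mul_exp_integral {d : ℕ} {T : ℝ} (hT : 0 ≤ T) {δ δ' : ℝ → Space d}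
    {a : ℝ → ℝ} (ha : Continuous a) (hδ : ∀ t ∈ Icc 0 T, HasDerivAt δ (δ' t) t)
    (hb : ∀ t ∈ Icc 0 T, ‖δ' t‖ ≤ a t * ‖δ t‖) :
    ‖δ 0‖ ≤ ‖δ T‖ * Real.exp (∫ t in (0 : ℝ)..T, a t) := by
  set A : ℝ → ℝ := fun s => ∫ t in (0 : ℝ)..s, a t with hA
  have hAd : ∀ s, HasDerivAt A (a s) s := fun s =>
    intervalIntegral.integral_hasDerivAt_right (ha.intervalIntegrable _ _)
      (ha.stronglyMeasurableAtFilter _ _) ha.continuousAt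
  have hf : ∀ s ∈ Icc 0 T, HasDerivAt (fun s => ‖δ s‖ ^ 2 * Real.exp (2 * A s))
      (2 * inner ℝ (δ s) (δ' s) * Real.exp (2 * A s) +
        ‖δ s‖ ^ 2 * (Real.exp (2 * A s) * (2 * a s))) s := fun s hs =>
    (hδ s hs).norm_sq.mul (((hAd s).const_mul 2).exp)
  -- The squared norm is differentiable even where `δ` vanishes, and its logarithmic rate is at
  -- least `-2 a`.
  have hmono : MonotoneOn (fun s => ‖δ s‖ ^ 2 * Real.exp (2 * A s)) (Icc 0 T) := by
    refine monotoneOn_of_hasDerivWithinAt_nonneg (convex_Icc 0 T)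
      (fun s hs => (hf s hs).continuousAt.continuousWithinAt)
      (fun s hs => (hf s (interior_subset hs)).hasDerivWithinAt) fun s hs => ?_
    have hs' := interior_subset hs
    have h1 : -(‖δ s‖ * (a s * ‖δ s‖)) ≤ inner ℝ (δ s) (δ' s) := by
      have h2 := (abs_le.1 (abs_real_inner_le_norm (δ s) (δ' s))).1
      have h3 := mul_le_mul_of_nonneg_left (hb s hs') (norm_nonneg (δ s))
      linarith
    have h4 : 0 ≤ 2 * (inner ℝ (δ s) (δ' s) + ‖δ s‖ * (a s * ‖δ s‖)) * Real.exp (2 * A s) := by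
      have := Real.exp_pos (2 * A s)
      exact mul_nonneg (by linarith) this.le
    linarith
  have h := hmono ⟨le_rfl, hT⟩ ⟨hT, le_rfl⟩ hT
  simp only [hA, intervalIntegral.integral_same, mul_zero, Real.exp_zero, mul_one] at h
  refine abs_le_of_sq_le_sq' ?_ (by positivity) |>.2
  rw [mul_pow, ← Real.exp_nat_mul]
  exact_mod_cast h

section Trajectories

variable {d : ℕ} {T : ℝ} {u : ℝ → Space d → Space d} {v : ℝ × Space d → Space d} {K B : ℝ≥0}
  {θ : ℝ → ℝ × Space d → ℝ × Space d} {G : ℝ → Space d → Space d →L[ℝ] Space d}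

/-- The position at time `s` of the particle that is at `x` at time `T`. -/
def trajectory (θ : ℝ → ℝ × Space d → ℝ × Space d) (T s : ℝ) (x : Space d) : Space d :=
  (θ (s - T) (T, x)).2

lemma continuous_trajectory (hv : IsLipschitzExtension T u v K B)
    (hθ : IsFlow (spaceTimeField v) θ) :
    Continuous fun q : ℝ × Space d => trajectory θ T q.1 q.2 := by
  have h := hθ.continuous_uncurry hv.lipschitz_spaceTimeField hv.norm_spaceTimeField_le
  exact continuous_snd.comp
    (h.comp (f := fun q : ℝ × Space d => (q.1 - T, T, q.2)) (by fun_prop))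

lemma trajectory_self (hθ : IsFlow (spaceTimeField v) θ) (x : Space d) :
    trajectory θ T T x = x := by
  simp [trajectory, hθ.zero]

lemma trajectory_add_latticeVec (hv : IsLipschitzExtension T u v K B)
    (hθ : IsFlow (spaceTimeField v) θ) (s : ℝ) (x : Space d) (k : Fin d → ℤ) :
    trajectory θ T s (x + latticeVec k) = trajectory θ T s x + latticeVec k := by
  have h := hv.flow_add_latticeVec hθ (s - T) (T, x) k
  rw [Prod.mk_add_mk, add_zero] at h
  rw [trajectory, h, Prod.snd_add, trajectory]

lemma hasDerivAt_trajectory (hv : IsLipschitzExtension T u v K B)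
    (hθ : IsFlow (spaceTimeField v) θ) {s : ℝ} (hs : s ∈ Icc 0 T) (x : Space d) :
    HasDerivAt (fun s => trajectory θ T s x) (u s (trajectory θ T s x)) s := by
  have h1 := (hθ.hasDerivAt (T, x) (s - T)).comp_sub_const s T
  have h2 : HasDerivAt (fun s => (θ (s - T) (T, x)).2) (v (θ (s - T) (T, x))) s := by
    simpa [spaceTimeField] using h1.hasFDerivAt.snd.hasDerivAt
  have e : θ (s - T) (T, x) = (s, trajectory θ T s x) := by
    refine Prod.ext ?_ rfl
    rw [hθ.fst_eq]
    ring
  have e2 : v (θ (s - T) (T, x)) = u s (trajectory θ T s x) := by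
    rw [e, hv.eq s hs]
  rwa [e2] at h2

/-- The maximal function of the gradient along the trajectory. -/
def stretchRate (θ : ℝ → ℝ × Space d → ℝ × Space d) (G : ℝ → Space d → Space d →L[ℝ] Space d)
    (T s : ℝ) (x : Space d) : ℝ :=
  maximalFun (d + 1) (fun y => ‖G s y‖) (trajectory θ T s x)

lemma stretchRate_nonneg (s : ℝ) (x : Space d) : 0 ≤ stretchRate θ G T s x :=
  maximalFun_nonneg (fun _ => norm_nonneg _) _

lemma continuous_stretchRate (hv : IsLipschitzExtension T u v K B)
    (hθ : IsFlow (spaceTimeField v) θ) (hG : Continuous fun z : ℝ × Space d => G z.1 z.2) :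
    Continuous fun q : ℝ × Space d => stretchRate θ G T q.1 q.2 := by
  have h := continuous_maximalFun_param (X := ℝ) (d + 1) (F := fun s (y : Space d) => ‖G s y‖)
    hG.norm
  exact h.comp (f := fun q : ℝ × Space d => (q.1, trajectory θ T q.1 q.2))
    (continuous_fst.prodMk (continuous_trajectory hv hθ))

lemma stretchRate_add_latticeVec (hv : IsLipschitzExtension T u v K B)
    (hθ : IsFlow (spaceTimeField v) θ) (hGp : ∀ t, IsPeriodic (G t)) (s : ℝ) (x : Space d)
    (k : Fin d → ℤ) : stretchRate θ G T s (x + latticeVec k) = stretchRate θ G T s x := by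
  unfold stretchRate
  rw [trajectory_add_latticeVec hv hθ]
  exact (isPeriodic_maximalFun fun i y => by simp only [hGp s i y]).add_latticeVec _ _

/-- The bound for the logarithmic change of the distance of two particles. -/
def logStretch (θ : ℝ → ℝ × Space d → ℝ × Space d) (G : ℝ → Space d → Space d →L[ℝ] Space d)
    (T : ℝ) (x y : Space d) : ℝ :=
  ∫ s in (0 : ℝ)..T, 2 ^ d * (stretchRate θ G T s x + stretchRate θ G T s y)

lemma norm_trajectory_sub_le (hT : 0 ≤ T) (hv : IsLipschitzExtension T u v K B)
    (hθ : IsFlow (spaceTimeField v) θ) (hup : ∀ t ∈ Icc 0 T, IsPeriodic (u t))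
    (hG : Continuous fun z : ℝ × Space d => G z.1 z.2)
    (hGd : ∀ t ∈ Icc 0 T, ∀ x, HasFDerivAt (u t) (G t x) x) (hGp : ∀ t, IsPeriodic (G t))
    (x y : Space d) :
    ‖trajectory θ T 0 x - trajectory θ T 0 y‖ ≤ ‖x - y‖ * Real.exp (logStretch θ G T x y) := by
  have hc : ∀ x, Continuous fun s => stretchRate θ G T s x := fun x =>
    (continuous_stretchRate hv hθ hG).comp (f := fun s : ℝ => (s, x)) (by fun_prop)
  have h := norm_le_norm_mul_exp_integral hT
    (a := fun s => 2 ^ d * (stretchRate θ G T s x + stretchRate θ G T s y))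
    (continuous_const.mul ((hc x).add (hc y)))
    (fun s hs => (hasDerivAt_trajectory hv hθ hs x).fun_sub (hasDerivAt_trajectory hv hθ hs y))
    (fun s hs => by
      refine (norm_sub_le_maximalFun_of_isPeriodic (hup s hs) (hGd s hs)
        (hG.comp (f := fun x : Space d => (s, x)) (by fun_prop)) (hGp s) _ _).trans (le_of_eq ?_)
      simp only [stretchRate]
      ring)
  simpa only [trajectory_self hθ, logStretch] using h

/-- The Euclidean estimate holds for every lattice translate of `x`, with the same `logStretch`; the
infimum over translates gives the torus version. -/
lemma torusDist_trajectory_le (hT : 0 ≤ T) (hv : IsLipschitzExtension T u v K B)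
    (hθ : IsFlow (spaceTimeField v) θ) (hup : ∀ t ∈ Icc 0 T, IsPeriodic (u t))
    (hG : Continuous fun z : ℝ × Space d => G z.1 z.2)
    (hGd : ∀ t ∈ Icc 0 T, ∀ x, HasFDerivAt (u t) (G t x) x) (hGp : ∀ t, IsPeriodic (G t))
    (x y : Space d) :
    torusDist (trajectory θ T 0 x) (trajectory θ T 0 y) ≤
      torusDist x y * Real.exp (logStretch θ G T x y) := by
  rw [← div_le_iff₀ (Real.exp_pos _)]
  refine le_ciInf fun k => ?_
  rw [div_le_iff₀ (Real.exp_pos _)]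
  have h := norm_trajectory_sub_le hT hv hθ hup hG hGd hGp (x + latticeVec k) y
  have e : logStretch θ G T (x + latticeVec k) y = logStretch θ G T x y := by
    simp only [logStretch, stretchRate_add_latticeVec hv hθ hGp]
  rw [trajectory_add_latticeVec hv hθ, e, add_sub_right_comm, add_sub_right_comm] at h
  exact (torusDist_le _ _ k).trans h

lemma ofReal_logStretch (hT : 0 ≤ T) (hv : IsLipschitzExtension T u v K B)
    (hθ : IsFlow (spaceTimeField v) θ) (hG : Continuous fun z : ℝ × Space d => G z.1 z.2)
    (x y : Space d) :
    ENNReal.ofReal (logStretch θ G T x y) = ∫⁻ s in Ioc 0 T, 2 ^ d *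
      (ENNReal.ofReal (stretchRate θ G T s x) + ENNReal.ofReal (stretchRate θ G T s y)) := by
  have hc : ∀ x, Continuous fun s => stretchRate θ G T s x := fun x =>
    (continuous_stretchRate hv hθ hG).comp (f := fun s : ℝ => (s, x)) (by fun_prop)
  rw [logStretch, intervalIntegral.integral_of_le hT, ofReal_integral_eq_lintegral_ofReal]
  · refine lintegral_congr fun s => ?_
    rw [ENNReal.ofReal_mul (by positivity), ENNReal.ofReal_pow (by norm_num),
      ENNReal.ofReal_ofNat, ENNReal.ofReal_add (stretchRate_nonneg s x) (stretchRate_nonneg s y)]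
  · exact ((continuous_const.mul ((hc x).add (hc y))).continuousOn.integrableOn_compact
      isCompact_Icc).mono_set Ioc_subset_Icc_self
  · exact Filter.Eventually.of_forall fun s =>
      mul_nonneg (by positivity) (add_nonneg (stretchRate_nonneg s x) (stretchRate_nonneg s y))

end Trajectories

/-! ### Integrals of extended-real costs -/

/-- The inequality `f ≤ g + b` rearranged into a form without subtraction, which survives
integration even where `f` or `g` is `-∞`. -/
lemma toENNReal_add_neg_le {f g : EReal} {b : ℝ} (hf : f ≠ ⊤) (hg : g ≠ ⊤)
    (h : f ≤ g + b) :
    f.toENNReal + (-g).toENNReal ≤ (-f).toENNReal + (g.toENNReal + ENNReal.ofReal b) := by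
  induction f with
  | top => exact absurd rfl hf
  | bot => simp
  | coe f =>
    induction g with
    | top => exact absurd rfl hg
    | bot => simp at h
    | coe g =>
      have h' : f ≤ g + b := by exact_mod_cast h
      rw [← EReal.coe_neg, ← EReal.coe_neg]
      simp only [EReal.toENNReal_of_ne_top (EReal.coe_ne_top _), EReal.toReal_coe]
      rcases le_total 0 f with hf0 | hf0 <;> rcases le_total 0 g with hg0 | hg0
      · rw [ENNReal.ofReal_of_nonpos (by linarith : -g ≤ 0),
          ENNReal.ofReal_of_nonpos (by linarith : -f ≤ 0), add_zero, zero_add]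
        exact (ENNReal.ofReal_le_ofReal h').trans ENNReal.ofReal_add_le
      · rw [ENNReal.ofReal_of_nonpos hg0, ENNReal.ofReal_of_nonpos (by linarith : -f ≤ 0),
          zero_add, zero_add, ← ENNReal.ofReal_add hf0 (by linarith)]
        exact ENNReal.ofReal_le_ofReal (by linarith)
      · rw [ENNReal.ofReal_of_nonpos hf0, ENNReal.ofReal_of_nonpos (by linarith : -g ≤ 0)]
        simp
      · rw [ENNReal.ofReal_of_nonpos hf0, ENNReal.ofReal_of_nonpos hg0, zero_add, zero_add]
        exact (ENNReal.ofReal_le_ofReal (by linarith)).trans ENNReal.ofReal_add_le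

/-- The positive parts have finite integrals. If the negative part of `f` has infinite integral, the
left side is `-∞`; otherwise the rearranged inequality forces the negative part of `g` to be
integrable, and everything is real. -/
lemma extIntegral_le_add {α : Type*} [MeasurableSpace α] {μ : Measure α} {f g : α → EReal}
    {b : α → ℝ} (hfm : Measurable f) (hgm : Measurable g) (hft : ∀ a, f a ≠ ⊤)
    (hgt : ∀ a, g a ≠ ⊤) (h : ∀ a, f a ≤ g a + b a)
    (hfi : ∫⁻ a, (f a).toENNReal ∂μ ≠ ⊤) (hgi : ∫⁻ a, (g a).toENNReal ∂μ ≠ ⊤)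
    (hbi : ∫⁻ a, ENNReal.ofReal (b a) ∂μ ≠ ⊤) :
    extIntegral μ f ≤ extIntegral μ g + ((∫⁻ a, ENNReal.ofReal (b a) ∂μ : ℝ≥0∞) : EReal) := by
  have key : ∫⁻ a, (f a).toENNReal ∂μ + ∫⁻ a, (-g a).toENNReal ∂μ ≤
      ∫⁻ a, (-f a).toENNReal ∂μ +
        (∫⁻ a, (g a).toENNReal ∂μ + ∫⁻ a, ENNReal.ofReal (b a) ∂μ) := by
    rw [← lintegral_add_left hfm.ereal_toENNReal, ← lintegral_add_left hgm.ereal_toENNReal,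
      ← lintegral_add_left (f := fun a => (-f a).toENNReal) hfm.neg.ereal_toENNReal]
    exact lintegral_mono fun a => toENNReal_add_neg_le (hft a) (hgt a) (h a)
  unfold extIntegral
  generalize ∫⁻ a, (f a).toENNReal ∂μ = A at *
  generalize ∫⁻ a, (g a).toENNReal ∂μ = D at *
  generalize ∫⁻ a, ENNReal.ofReal (b a) ∂μ = β at *
  generalize ∫⁻ a, (-f a).toENNReal ∂μ = A' at *
  generalize ∫⁻ a, (-g a).toENNReal ∂μ = D' at *
  lift A to ℝ≥0 using hfi
  lift D to ℝ≥0 using hgi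
  lift β to ℝ≥0 using hbi
  rcases eq_or_ne A' ⊤ with rfl | hA'
  · simp
  lift A' to ℝ≥0 using hA'
  have hD' : D' ≠ ⊤ := by
    refine ne_top_of_le_ne_top ?_ (le_add_self.trans key)
    exact_mod_cast ENNReal.coe_ne_top
  lift D' to ℝ≥0 using hD'
  have hr : (A : ℝ) + D' ≤ A' + (D + β) := by exact_mod_cast key
  have hr' : (((A : ℝ) - A' : ℝ) : EReal) ≤ ((D - D' + β : ℝ) : EReal) :=
    EReal.coe_le_coe_iff.2 (by linarith)
  rw [EReal.coe_sub, EReal.coe_add, EReal.coe_sub] at hr'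
  exact hr'

lemma measurable_lnCost : Measurable lnCost :=
  ENNReal.measurable_log.comp ENNReal.measurable_ofReal

lemma lnCost_ne_top (z : ℝ) : lnCost z ≠ ⊤ :=
  ENNReal.log_eq_top_iff.not.2 ENNReal.ofReal_ne_top

lemma lnCost_mono {a b : ℝ} (h : a ≤ b) : lnCost a ≤ lnCost b :=
  ENNReal.log_monotone (ENNReal.ofReal_le_ofReal h)

lemma lnCost_mul_exp {a : ℝ} (b : ℝ) : lnCost (a * Real.exp b) = lnCost a + b := by
  rw [lnCost, ENNReal.ofReal_mul' (Real.exp_pos b).le, ENNReal.log_mul_add,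
    ENNReal.log_ofReal_of_pos (Real.exp_pos b), Real.log_exp, lnCost]

/-! ### Transport plans under the flow and the gradient budget -/

/-- The torus has finite diameter, so the logarithm is bounded above; only its negative part can
fail to be integrable. -/
lemma lintegral_toENNReal_lnCost_ne_top {d : ℕ} {π : Measure (Space d × Space d)}
    [IsFiniteMeasure π] {f : Space d × Space d → ℝ} (hf : ∀ z, f z ≤ d + 1) :
    ∫⁻ z, (lnCost (f z)).toENNReal ∂π ≠ ⊤ := by
  refine ne_top_of_le_ne_top ?_ (lintegral_mono fun z =>
    EReal.toENNReal_le_toENNReal (lnCost_mono (hf z)))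
  rw [lintegral_const]
  exact ENNReal.mul_ne_top (EReal.toENNReal_ne_top_iff.2 (lnCost_ne_top _)) (measure_ne_top _ _)

lemma gradBudget_ne_top {d : ℕ} {T : ℝ} {u : ℝ → Space d → Space d} (p : ℝ≥0∞) {K : ℝ≥0}
    {G : ℝ → Space d → Space d →L[ℝ] Space d}
    (hGd : ∀ t ∈ Icc 0 T, ∀ x, HasFDerivAt (u t) (G t x) x) (hGK : ∀ t x, ‖G t x‖ ≤ K) :
    gradBudget p (Icc 0 T) u ≠ ⊤ := by
  have h : gradBudget p (Icc 0 T) u ≤ ∫⁻ _t in Icc 0 T, (K : ℝ≥0∞) := by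
    refine setLIntegral_mono' measurableSet_Icc fun t ht => ?_
    have h1 := eLpNorm_le_of_ae_bound (p := p) (μ := volume.restrict (cell d))
      (f := fun x => fderiv ℝ (u t) x) (C := K) (Filter.Eventually.of_forall fun x => by
        rw [(hGd t ht x).fderiv]
        exact hGK t x)
    simpa using h1
  refine ne_top_of_le_ne_top ?_ h
  rw [lintegral_const]
  exact ENNReal.mul_ne_top ENNReal.coe_ne_top (by simp)

/-- Changing variables along the flow replaces the maximal function at the moving point by an
integral against the transported measure, whose density is at most `2`. -/
lemma lintegral_stretchRate_le {d : ℕ} {T : ℝ} {u : ℝ → Space d → Space d}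
    {v : ℝ × Space d → Space d} {K B : ℝ≥0} {θ : ℝ → ℝ × Space d → ℝ × Space d}
    {G : ℝ → Space d → Space d →L[ℝ] Space d}
    (hG : Continuous fun z : ℝ × Space d => G z.1 z.2)
    (hGp : ∀ t, IsPeriodic (G t)) {s : ℝ} {μ ν : Measure (Space d)}
    (hv : IsLipschitzExtension T u v K B) (hθ : IsFlow (spaceTimeField v) θ)
    (hmap : μ.map (fun x => wrap (θ (s - T) (T, x)).2) = ν)
    (hν : ν ≤ (2 : ℝ≥0∞) • volume.restrict (cell d)) :
    ∫⁻ x, ENNReal.ofReal (stretchRate θ G T s x) ∂μ ≤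
      2 * ∫⁻ x in cell d, ENNReal.ofReal (maximalFun (d + 1) (fun y => ‖G s y‖) x) := by
  have hGs : Continuous (G s) := hG.comp (f := fun x : Space d => (s, x)) (by fun_prop)
  have hM : Measurable fun x => ENNReal.ofReal (maximalFun (d + 1) (fun y => ‖G s y‖) x) :=
    (continuous_maximalFun (d + 1) hGs.norm).measurable.ennreal_ofReal
  have hper : IsPeriodic (maximalFun (d + 1) fun y => ‖G s y‖) :=
    isPeriodic_maximalFun fun i y => by simp only [hGp s i y]
  have hX : Measurable fun x => wrap (θ (s - T) (T, x)).2 :=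
    measurable_wrap.comp ((continuous_trajectory hv hθ).comp
      (f := fun x : Space d => (s, x)) (by fun_prop)).measurable
  calc ∫⁻ x, ENNReal.ofReal (stretchRate θ G T s x) ∂μ
      = ∫⁻ x, ENNReal.ofReal (maximalFun (d + 1) (fun y => ‖G s y‖) x) ∂ν := by
        rw [← hmap, lintegral_map hM hX]
        refine lintegral_congr fun x => ?_
        rw [hper.comp_wrap, stretchRate, trajectory]
    _ ≤ ∫⁻ x, ENNReal.ofReal (maximalFun (d + 1) (fun y => ‖G s y‖) x)
          ∂((2 : ℝ≥0∞) • volume.restrict (cell d)) := lintegral_mono' hν le_rfl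
    _ = _ := by rw [lintegral_smul_measure, smul_eq_mul]

lemma map_prodMap_mem_transportPlans {d : ℕ} {f g f' g' : Space d → ℝ}
    {π : Measure (Space d × Space d)} (hπ : π ∈ transportPlans f g) {Y : Space d → Space d}
    (hY : Measurable Y) (hf : (densityMeasure f).map Y = densityMeasure f')
    (hg : (densityMeasure g).map Y = densityMeasure g') :
    π.map (Prod.map Y Y) ∈ transportPlans f' g' := by
  obtain ⟨hπ, hπ1, hπ2⟩ := hπ
  have hYY : Measurable (Prod.map Y Y) := hY.prodMap hY
  refine ⟨Measure.isProbabilityMeasure_map hYY.aemeasurable, ?_, ?_⟩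
  · have e : Prod.fst ∘ Prod.map Y Y = Y ∘ Prod.fst := rfl
    rw [Measure.map_map measurable_fst hYY, e, ← Measure.map_map hY measurable_fst, hπ1, hf]
  · have e : Prod.snd ∘ Prod.map Y Y = Y ∘ Prod.snd := rfl
    rw [Measure.map_map measurable_snd hYY, e, ← Measure.map_map hY measurable_snd, hπ2, hg]

lemma extIntegral_map {α β : Type*} [MeasurableSpace α] [MeasurableSpace β] {μ : Measure α}
    {Y : α → β} (hY : Measurable Y) {f : β → EReal} (hf : Measurable f) :
    extIntegral (μ.map Y) f = extIntegral μ (fun a => f (Y a)) := by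
  unfold extIntegral
  rw [lintegral_map hf.ereal_toENNReal hY,
    lintegral_map (f := fun z => (-f z).toENNReal) hf.neg.ereal_toENNReal hY]

/-- By Tonelli, each time slice splits into one integral per marginal. Each is at most `2 C N s`,
which together with the `2 ^ d` in `logStretch` gives `2 ^ d * (4 * C)`. Only the marginals of `π`
enter. -/
lemma lintegral_logStretch_le {d : ℕ} {T : ℝ} (hT : 0 ≤ T) {u : ℝ → Space d → Space d}
    {v : ℝ × Space d → Space d} {K B : ℝ≥0} {θ : ℝ → ℝ × Space d → ℝ × Space d}
    {G : ℝ → Space d → Space d →L[ℝ] Space d}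
    (hG : Continuous fun z : ℝ × Space d => G z.1 z.2) (hGp : ∀ t, IsPeriodic (G t))
    (hv : IsLipschitzExtension T u v K B) (hθ : IsFlow (spaceTimeField v) θ)
    {ρ : ℝ → Space d → ℝ} (hρ : IsBinarySolution (Icc 0 T) u ρ)
    {π : Measure (Space d × Space d)}
    (hπ : π ∈ transportPlans (fun x => 2 * max (ρ T x) 0) (fun x => -2 * min (ρ T x) 0))
    {C : ℝ≥0} {N : ℝ → ℝ≥0∞}
    (hslice : ∀ s ∈ Icc 0 T,
      ∫⁻ x in cell d, ENNReal.ofReal (maximalFun (d + 1) (fun y => ‖G s y‖) x) ≤ C * N s) :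
    ∫⁻ z, ENNReal.ofReal (logStretch θ G T z.1 z.2) ∂π ≤
      (2 ^ d * (4 * C) : ℝ≥0) * ∫⁻ s in Icc 0 T, N s := by
  obtain ⟨hπ, hπ1, hπ2⟩ := hπ
  have hS : Continuous fun q : ℝ × Space d => stretchRate θ G T q.1 q.2 :=
    continuous_stretchRate hv hθ hG
  have hm1 : Measurable fun q : (Space d × Space d) × ℝ =>
      ENNReal.ofReal (stretchRate θ G T q.2 q.1.1) :=
    (hS.comp (f := fun q : (Space d × Space d) × ℝ => (q.2, q.1.1))
      (by fun_prop)).measurable.ennreal_ofReal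
  have hm2 : Measurable fun q : (Space d × Space d) × ℝ =>
      ENNReal.ofReal (stretchRate θ G T q.2 q.1.2) :=
    (hS.comp (f := fun q : (Space d × Space d) × ℝ => (q.2, q.1.2))
      (by fun_prop)).measurable.ennreal_ofReal
  have hm0 : ∀ s, Measurable fun x => ENNReal.ofReal (stretchRate θ G T s x) := fun s =>
    (hS.comp (f := fun x : Space d => (s, x)) (by fun_prop)).measurable.ennreal_ofReal
  simp only [ofReal_logStretch hT hv hθ hG]
  rw [lintegral_lintegral_swap ((hm1.add hm2).const_mul _).aemeasurable]
  calc ∫⁻ s in Ioc 0 T, ∫⁻ z, 2 ^ d * (ENNReal.ofReal (stretchRate θ G T s z.1) +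
          ENNReal.ofReal (stretchRate θ G T s z.2)) ∂π
      ≤ ∫⁻ s in Ioc 0 T, ((2 ^ d * (4 * C) : ℝ≥0) : ℝ≥0∞) * N s := by
        refine setLIntegral_mono' measurableSet_Ioc fun s hs => ?_
        have hs' : s ∈ Icc 0 T := ⟨hs.1.le, hs.2⟩
        obtain ⟨hs1, hs2⟩ := hρ.map_flow hv hθ hs' ⟨hT, le_rfl⟩
        have e1 : ∫⁻ z, ENNReal.ofReal (stretchRate θ G T s z.1) ∂π =
            ∫⁻ x, ENNReal.ofReal (stretchRate θ G T s x) ∂(plusMeasure (ρ T)) := by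
          rw [plusMeasure, ← hπ1, lintegral_map (hm0 s) measurable_fst]
        have e2 : ∫⁻ z, ENNReal.ofReal (stretchRate θ G T s z.2) ∂π =
            ∫⁻ x, ENNReal.ofReal (stretchRate θ G T s x) ∂(minusMeasure (ρ T)) := by
          rw [minusMeasure, ← hπ2, lintegral_map (hm0 s) measurable_snd]
        have h1 := (lintegral_stretchRate_le hG hGp hv hθ hs1
          (plusMeasure_le (hρ.binary s hs'))).trans (mul_le_mul' le_rfl (hslice s hs'))
        have h2 := (lintegral_stretchRate_le hG hGp hv hθ hs2
          (minusMeasure_le (hρ.binary s hs'))).trans (mul_le_mul' le_rfl (hslice s hs'))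
        have hma : Measurable fun z : Space d × Space d =>
            ENNReal.ofReal (stretchRate θ G T s z.1) := (hm0 s).comp measurable_fst
        have hmb : Measurable fun z : Space d × Space d =>
            ENNReal.ofReal (stretchRate θ G T s z.2) := (hm0 s).comp measurable_snd
        rw [lintegral_const_mul _ (hma.fun_add hmb), lintegral_add_left hma, e1, e2]
        refine (mul_le_mul' le_rfl (add_le_add h1 h2)).trans (le_of_eq ?_)
        push_cast
        ring
    _ = ((2 ^ d * (4 * C) : ℝ≥0) : ℝ≥0∞) * ∫⁻ s in Ioc 0 T, N s :=
        lintegral_const_mul' _ _ ENNReal.coe_ne_top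
    _ ≤ _ := mul_le_mul' le_rfl (lintegral_mono_set Ioc_subset_Icc_self)

lemma measurable_logCost {α : Type*} [MeasurableSpace α] {d : ℕ} {Z : α → Space d × Space d}
    (hZ : Measurable Z) : Measurable fun z => lnCost (torusDist (Z z).1 (Z z).2) := by
  have h : Measurable fun z : Space d × Space d => lnCost (torusDist z.1 z.2) :=
    measurable_lnCost.comp measurable_torusDist
  exact h.comp hZ

lemma extIntegral_logCost_le {d : ℕ} {π : Measure (Space d × Space d)} [IsFiniteMeasure π]
    {Z : Space d × Space d → Space d × Space d} (hZ : Measurable Z)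
    {b : Space d × Space d → ℝ} (hb : ∫⁻ z, ENNReal.ofReal (b z) ∂π ≠ ⊤)
    (h : ∀ z, torusDist (Z z).1 (Z z).2 ≤ torusDist z.1 z.2 * Real.exp (b z)) :
    extIntegral (π.map Z) (fun z => lnCost (torusDist z.1 z.2)) ≤
      extIntegral π (fun z => lnCost (torusDist z.1 z.2)) +
        ((∫⁻ z, ENNReal.ofReal (b z) ∂π : ℝ≥0∞) : EReal) := by
  rw [extIntegral_map hZ (f := fun z => lnCost (torusDist z.1 z.2))
    (measurable_logCost measurable_id)]
  have hpoint : ∀ z, lnCost (torusDist (Z z).1 (Z z).2) ≤ lnCost (torusDist z.1 z.2) + b z :=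
    fun z => (lnCost_mono (h z)).trans_eq (lnCost_mul_exp _)
  have hdiam : ∀ z, torusDist (Z z).1 (Z z).2 ≤ d + 1 := fun z => torusDist_le_diam _ _
  have hdiam' : ∀ z : Space d × Space d, torusDist z.1 z.2 ≤ d + 1 :=
    fun z => torusDist_le_diam _ _
  exact extIntegral_le_add (f := fun z => lnCost (torusDist (Z z).1 (Z z).2))
    (g := fun z => lnCost (torusDist z.1 z.2)) (b := b) (measurable_logCost hZ)
    (measurable_logCost measurable_id) (fun z => lnCost_ne_top _) (fun z => lnCost_ne_top _)
    hpoint (lintegral_toENNReal_lnCost_ne_top hdiam) (lintegral_toENNReal_lnCost_ne_top hdiam') hb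

lemma mkrDist_lnCost_le_of_map {d : ℕ} {f g f' g' : Space d → ℝ}
    {π : Measure (Space d × Space d)} (hπ : π ∈ transportPlans f g) {Y : Space d → Space d}
    (hY : Measurable Y) (hf : (densityMeasure f).map Y = densityMeasure f')
    (hg : (densityMeasure g).map Y = densityMeasure g')
    {b : Space d → Space d → ℝ} (hb : ∫⁻ z, ENNReal.ofReal (b z.1 z.2) ∂π ≠ ⊤)
    (h : ∀ x y, torusDist (Y x) (Y y) ≤ torusDist x y * Real.exp (b x y)) :
    mkrDist lnCost f' g' ≤ extIntegral π (fun z => lnCost (torusDist z.1 z.2)) +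
      ((∫⁻ z, ENNReal.ofReal (b z.1 z.2) ∂π : ℝ≥0∞) : EReal) := by
  have := hπ.1
  have hplan := map_prodMap_mem_transportPlans hπ hY hf hg
  have h1 : mkrDist lnCost f' g' ≤
      extIntegral (π.map (Prod.map Y Y)) (fun z => lnCost (torusDist z.1 z.2)) := by
    unfold mkrDist
    exact iInf₂_le (π.map (Prod.map Y Y)) hplan
  exact h1.trans (extIntegral_logCost_le (b := fun z => b z.1 z.2) (hY.prodMap hY) hb
    fun z => h z.1 z.2)

lemma mkrDist_le_extIntegral_add {d : ℕ} {T : ℝ} (hT : 0 ≤ T) {u : ℝ → Space d → Space d}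
    {v : ℝ × Space d → Space d} {K B : ℝ≥0} {θ : ℝ → ℝ × Space d → ℝ × Space d}
    {G : ℝ → Space d → Space d →L[ℝ] Space d}
    (hup : ∀ t ∈ Icc 0 T, IsPeriodic (u t))
    (hG : Continuous fun z : ℝ × Space d => G z.1 z.2)
    (hGd : ∀ t ∈ Icc 0 T, ∀ x, HasFDerivAt (u t) (G t x) x) (hGp : ∀ t, IsPeriodic (G t))
    (hv : IsLipschitzExtension T u v K B) (hθ : IsFlow (spaceTimeField v) θ)
    {ρ : ℝ → Space d → ℝ} (hρ : IsBinarySolution (Icc 0 T) u ρ)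
    {π : Measure (Space d × Space d)}
    (hπ : π ∈ transportPlans (fun x => 2 * max (ρ T x) 0) (fun x => -2 * min (ρ T x) 0))
    (hb : ∫⁻ z, ENNReal.ofReal (logStretch θ G T z.1 z.2) ∂π ≠ ⊤) :
    mkrDist lnCost (fun x => 2 * max (ρ 0 x) 0) (fun x => -2 * min (ρ 0 x) 0) ≤
      extIntegral π (fun z => lnCost (torusDist z.1 z.2)) +
        ((∫⁻ z, ENNReal.ofReal (logStretch θ G T z.1 z.2) ∂π : ℝ≥0∞) : EReal) := by
  have hmap := hρ.map_flow hv hθ (s := 0) (t := T) ⟨le_rfl, hT⟩ ⟨hT, le_rfl⟩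
  have hYm : Measurable fun x => wrap (θ (0 - T) (T, x)).2 :=
    measurable_wrap.comp ((continuous_trajectory hv hθ).comp
      (f := fun x : Space d => ((0 : ℝ), x)) (by fun_prop)).measurable
  refine mkrDist_lnCost_le_of_map hπ hYm hmap.1 hmap.2 hb fun x y => ?_
  rw [torusDist_wrap]
  exact torusDist_trajectory_le hT hv hθ hup hG hGd hGp x y

/-- The logarithmic distance changes at most by a multiple of the gradient budget. -/
lemma exists_mkrDist_le_add_gradBudget (d : ℕ) {p : ℝ≥0∞} (hp : 1 < p) :
    ∃ c : ℝ≥0, 0 < c ∧ ∀ T : ℝ, 0 < T →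
      ∀ (u : ℝ → Space d → Space d) (ρ : ℝ → Space d → ℝ),
        IsStirringField (Icc 0 T) u → IsBinarySolution (Icc 0 T) u ρ →
        gradBudget p (Icc 0 T) u ≠ ⊤ ∧
        mkrDist lnCost (fun x => 2 * max (ρ 0 x) 0) (fun x => -2 * min (ρ 0 x) 0) ≤
          mkrDist lnCost (fun x => 2 * max (ρ T x) 0) (fun x => -2 * min (ρ T x) 0) +
            ((c * gradBudget p (Icc 0 T) u : ℝ≥0∞) : EReal) := by
  -- The finite exponent `min p 2` also covers `p = ∞`; as the cell has measure `1`, its norm is at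
  -- most the `L^p` norm.
  have hq : 1 < (min p 2).toReal := by
    rw [← ENNReal.toReal_one]
    exact (ENNReal.toReal_lt_toReal ENNReal.one_ne_top (by simp)).2
      (lt_min hp (by norm_num))
  have hq2 : ENNReal.ofReal (min p 2).toReal = min p 2 := ENNReal.ofReal_toReal (by simp)
  obtain ⟨C, hC⟩ := exists_lintegral_maximalFun_le d (R := d + 1) (by positivity) hq
  rw [hq2] at hC
  -- The summand `1` keeps the constant positive when `C = 0`.
  obtain ⟨c, hc0, hc⟩ : ∃ c : ℝ≥0, 0 < c ∧ 2 ^ d * (4 * C) ≤ c :=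
    ⟨2 ^ d * (4 * C) + 1, by positivity, le_add_of_nonneg_right zero_le_one⟩
  refine ⟨c, hc0, fun T hT u ρ hu hρ => ?_⟩
  obtain ⟨v, K, B, G, hv, hG, hGd, hGp, hGK⟩ := hu.exists_extension hT
  obtain ⟨θ, hθ⟩ := exists_isFlow hv.lipschitz_spaceTimeField hv.norm_spaceTimeField_le
  have hbudget := gradBudget_ne_top p hGd hGK
  have hslice : ∀ s ∈ Icc 0 T,
      ∫⁻ x in cell d, ENNReal.ofReal (maximalFun (d + 1) (fun y => ‖G s y‖) x) ≤
        C * eLpNorm (fun x => fderiv ℝ (u s) x) p (volume.restrict (cell d)) := by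
    intro s hs
    have hGs : Continuous (G s) := hG.comp (f := fun x : Space d => (s, x)) (by fun_prop)
    refine (hC _ hGs.norm (fun _ => norm_nonneg _) fun i y => by simp only [hGp s i y]).trans ?_
    have e : (fun x => fderiv ℝ (u s) x) = G s := funext fun x => (hGd s hs x).fderiv
    rw [e, eLpNorm_norm]
    exact mul_le_mul' le_rfl
      (eLpNorm_le_eLpNorm_of_exponent_le (min_le_left _ _) hGs.aestronglyMeasurable)
  refine ⟨hbudget, ?_⟩
  have hfin : ((c * gradBudget p (Icc 0 T) u : ℝ≥0∞) : EReal) ≠ ⊤ := by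
    rw [Ne, EReal.coe_ennreal_eq_top_iff]
    exact ENNReal.mul_ne_top ENNReal.coe_ne_top hbudget
  have hfin' : ((c * gradBudget p (Icc 0 T) u : ℝ≥0∞) : EReal) ≠ ⊥ :=
    EReal.coe_ennreal_ne_bot _
  -- The budget is finite, so it can be moved across the inequality; this frees the infimum over
  -- plans at time `T`, and each plan is then treated alone.
  rw [← EReal.sub_le_iff_le_add (Or.inl hfin') (Or.inl hfin)]
  refine le_iInf₂ fun π hπ => ?_
  rw [EReal.sub_le_iff_le_add (Or.inl hfin') (Or.inl hfin)]
  have hb : ∫⁻ z, ENNReal.ofReal (logStretch θ G T z.1 z.2) ∂π ≤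
      c * gradBudget p (Icc 0 T) u :=
    (lintegral_logStretch_le hT.le hG hGp hv hθ hρ hπ hslice).trans
      (mul_le_mul' (ENNReal.coe_le_coe.2 hc) le_rfl)
  refine (mkrDist_le_extIntegral_add hT.le hu.periodic hG hGd hGp hv hθ hρ hπ
    (ne_top_of_le_ne_top (ENNReal.mul_ne_top ENNReal.coe_ne_top hbudget) hb)).trans ?_
  exact add_le_add le_rfl (EReal.coe_ennreal_le_coe_ennreal_iff.2 hb)

/-! ### Shorter time intervals and exponentiation -/

lemma IsStirringField.mono {d : ℕ} {J J' : Set ℝ} {u : ℝ → Space d → Space d}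
    (hu : IsStirringField J u) (h : J' ⊆ J) : IsStirringField J' u where
  smooth := hu.smooth.mono (prod_mono h le_rfl)
  periodic t ht := hu.periodic t (h ht)
  div_free t ht := hu.div_free t (h ht)

lemma IsBinarySolution.mono {d : ℕ} {J J' : Set ℝ} {u : ℝ → Space d → Space d}
    {ρ : ℝ → Space d → ℝ} (hρ : IsBinarySolution J u ρ) (h : J' ⊆ J) :
    IsBinarySolution J' u ρ where
  measurable := hρ.measurable.mono_measure (Measure.restrict_mono (prod_mono h le_rfl) le_rfl)
  measurable_slice t ht := hρ.measurable_slice t (h ht)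
  periodic t ht := hρ.periodic t (h ht)
  binary t ht := hρ.binary t (h ht)
  mean_zero := hρ.mean_zero
  weak φ hφ hφp t ht := hρ.weak φ hφ hφp t (h ht)

lemma exp_mul_exp_neg_le {a b : EReal} {x : ℝ≥0∞} (hx : x ≠ ⊤) (h : a ≤ b + x) :
    EReal.exp a * EReal.exp (-(x : EReal)) ≤ EReal.exp b := by
  rw [← EReal.exp_add, EReal.exp_le_exp_iff, ← sub_eq_add_neg]
  exact (EReal.sub_le_iff_le_add (Or.inl (EReal.coe_ennreal_ne_bot _))
    (Or.inl (by simpa using hx))).2 h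

lemma mul_exp_neg_pos {a x : ℝ≥0∞} (ha : 0 < a) (hx : x ≠ ⊤) :
    0 < a * EReal.exp (-(x : EReal)) := by
  refine ENNReal.mul_pos ha.ne' ?_
  rw [Ne, EReal.exp_eq_zero_iff, EReal.neg_eq_bot_iff, EReal.coe_ennreal_eq_top_iff]
  exact hx

end Mixing

end

theorem theorem1 (d : ℕ) (p : ℝ≥0∞) (hp : 1 < p) :
    ∃ c : ℝ≥0, 0 < c ∧ ∀ T : ℝ, 0 < T →
      ∀ (u : ℝ → Mixing.Space d → Mixing.Space d) (ρ : ℝ → Mixing.Space d → ℝ),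
        -- the lower bound, and positivity at time `T`
        (Mixing.IsStirringField (Icc 0 T) u → Mixing.IsBinarySolution (Icc 0 T) u ρ →
          Mixing.mixingMeasure (ρ 0) *
              EReal.exp (-((c * Mixing.gradBudget p (Icc 0 T) u : ℝ≥0∞) : EReal)) ≤
            Mixing.mixingMeasure (ρ T) ∧
          (0 < Mixing.mixingMeasure (ρ 0) → 0 < Mixing.mixingMeasure (ρ T))) ∧
        -- no approach to perfect mixing as `t ↑ T`, if the gradient is integrable up to `T`
        (Mixing.IsStirringField (Ico 0 T) u → Mixing.IsBinarySolution (Ico 0 T) u ρ →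
          Mixing.gradBudget p (Ico 0 T) u < ⊤ → 0 < Mixing.mixingMeasure (ρ 0) →
          ∃ δ : ℝ≥0∞, 0 < δ ∧ ∀ t ∈ Ico 0 T, δ ≤ Mixing.mixingMeasure (ρ t)) := by
  obtain ⟨c, hc, h⟩ := Mixing.exists_mkrDist_le_add_gradBudget d hp
  have key : ∀ T : ℝ, 0 < T →
      ∀ (u : ℝ → Mixing.Space d → Mixing.Space d) (ρ : ℝ → Mixing.Space d → ℝ),
        Mixing.IsStirringField (Icc 0 T) u → Mixing.IsBinarySolution (Icc 0 T) u ρ →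
        Mixing.gradBudget p (Icc 0 T) u ≠ ⊤ ∧ Mixing.mixingMeasure (ρ 0) *
          EReal.exp (-((c * Mixing.gradBudget p (Icc 0 T) u : ℝ≥0∞) : EReal)) ≤
            Mixing.mixingMeasure (ρ T) := fun T hT u ρ hu hρ =>
    have h1 := h T hT u ρ hu hρ
    ⟨h1.1, Mixing.exp_mul_exp_neg_le (ENNReal.mul_ne_top ENNReal.coe_ne_top h1.1) h1.2⟩
  refine ⟨c, hc, fun T hT u ρ => ⟨fun hu hρ => ?_, fun hu hρ hfin h0 => ?_⟩⟩
  · obtain ⟨hb, hle⟩ := key T hT u ρ hu hρ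
    exact ⟨hle, fun h0 => (Mixing.mul_exp_neg_pos h0
      (ENNReal.mul_ne_top ENNReal.coe_ne_top hb)).trans_le hle⟩
  -- The witness is the initial mixing measure times `exp` of `-c` times the budget of all of `[0,
  -- T)`, a lower bound for the estimate on every `[0, t]`.
  · refine ⟨_, Mixing.mul_exp_neg_pos h0 (ENNReal.mul_ne_top ENNReal.coe_ne_top hfin.ne :
      c * Mixing.gradBudget p (Ico 0 T) u ≠ ⊤), fun t ht => ?_⟩
    -- The estimate needs an interval of positive length; at `t = 0` it suffices that the
    -- exponential factor is at most `1`.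
    rcases ht.1.eq_or_lt with rfl | ht0
    · refine mul_le_of_le_one_right' ?_
      rw [EReal.exp_le_one_iff, EReal.neg_le_zero]
      exact EReal.coe_ennreal_nonneg _
    · have hsub : Icc 0 t ⊆ Ico 0 T := fun s hs => ⟨hs.1, hs.2.trans_lt ht.2⟩
      refine le_trans ?_ (key t ht0 u ρ (hu.mono hsub) (hρ.mono hsub)).2
      refine mul_le_mul' le_rfl (EReal.exp_monotone (EReal.neg_le_neg_iff.2
        (EReal.coe_ennreal_le_coe_ennreal_iff.2 (mul_le_mul' le_rfl ?_))))
      exact lintegral_mono_set hsub
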